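/- For $N\ge 1$, $f\colon \mathbb{Z}/N\mathbb{Z}\to\mathbb{C}$ and $r\in\mathbb{Z}/N\mathbb{Z}$ let $\widehat f(r)=\frac1N\sum_{n\in\mathbb{Z}/N\mathbb{Z}} f(n)e^{-2\pi i rn/N}$. A set $A\subseteq\mathbb{Z}/N\mathbb{Z}$ is called $\eta$-Fourier uniform if $|\widehat{1_A}(r)|\le\eta$ for all $r\neq 0$, and its 4-AP density is $$\Lambda_4(1_A)=\frac1{N^2}\sum_{n,d\in\mathbb{Z}/N\mathbb{Z}}1_A(n)1_A(n+d)1_A(n+2d)1_A(n+3d).$$ For $0<\alpha<1$ let $\rho_4(\alpha)$ be the largest real number (the supremum of the real numbers) $c$ such that for every $\epsilon>0$ there exist $\eta>0$ and $N_0$ such that every $\eta$-Fourier uniform $A\subseteq\mathbb{Z}/N\mathbb{Z}$ with $N\ge N_0$ and $|A|\ge(\alpha-\epsilon)N$ satisfies $\Lambda_4(1_A)\ge c-\epsilon$. Then, uniformly for $0<\alpha<1$, $$\rho_4(\alpha)=O\bigl(\alpha^{3+\frac12\log_3 22}\bigr)\qquad\text{and}\qquad \rho_4(\alpha)=O\bigl(\alpha^{4.406}\bigr),$$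 with absolute implied constants. Consequently $\rho_4(\alpha)<\alpha^{4.4}$ for all sufficiently small $\alpha>0$. Moreover, there is $\alpha_0>0$ such that for all $0<\alpha<\alpha_0$, all $\eta>0$ and all $N_0$ there exist $N\ge N_0$ and an $\eta$-Fourier uniform set $A\subseteq\mathbb{Z}/N\mathbb{Z}$ with $\alpha\le |A|/N\le\alpha+\eta$ and $\Lambda_4(1_A)<\alpha^{4.4}$. -/

import Mathlib

namespace FourAP

/-- The Fourier transform on `ℤ/Nℤ`, normalised as an average:
`𝔼 n, f n * exp (-2πi r n / N)`. (`ZMod.stdAddChar j = exp (2πi j / N)`.) -/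
noncomputable def fourier {N : ℕ} [NeZero N] (f : ZMod N → ℂ) (r : ZMod N) : ℂ :=
  (∑ n : ZMod N, f n * ZMod.stdAddChar (-(r * n))) / (N : ℂ)

/-- `A ⊆ ℤ/Nℤ` is `η`-Fourier uniform: `|(1_A)^(r)| ≤ η` for all `r ≠ 0`. -/
def FourierUniform {N : ℕ} [NeZero N] (η : ℝ) (A : Finset (ZMod N)) : Prop :=
  ∀ r : ZMod N, r ≠ 0 → ‖fourier ((A : Set (ZMod N)).indicator 1) r‖ ≤ η

/-- `Λ₄(f) = 𝔼 n d, f n * f (n + d) * f (n + 2d) * f (n + 3d)`. -/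
noncomputable def Lambda {N : ℕ} [NeZero N] (f : ZMod N → ℝ) : ℝ :=
  (∑ n : ZMod N, ∑ d : ZMod N, f n * f (n + d) * f (n + 2 * d) * f (n + 3 * d)) / (N : ℝ) ^ 2

/-- The 4-AP density `Λ₄(1_A)` of a set `A ⊆ ℤ/Nℤ`. -/
noncomputable def apDensity {N : ℕ} [NeZero N] (A : Finset (ZMod N)) : ℝ :=
  Lambda ((A : Set (ZMod N)).indicator 1)

/-- The real numbers `c` such that for every `ε > 0` there are `η > 0` and `N₀` such that every
`η`-Fourier uniform `A ⊆ ℤ/Nℤ` with `N ≥ N₀` and `|A| ≥ (α - ε) N` has `Λ₄(1_A) ≥ c - ε`. -/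
def admissible (α : ℝ) : Set ℝ :=
  {c | ∀ ε : ℝ, 0 < ε → ∃ η : ℝ, 0 < η ∧ ∃ N₀ : ℕ, ∀ (N : ℕ) [NeZero N], N₀ ≤ N →
    ∀ A : Finset (ZMod N), FourierUniform η A → (α - ε) * (N : ℝ) ≤ (A.card : ℝ) →
      c - ε ≤ apDensity A}

/-- `ρ₄(α)`, the largest (supremal) admissible real number. -/
noncomputable def rho (α : ℝ) : ℝ := sSup (admissible α)

theorem apDensity_nonneg {N : ℕ} [NeZero N] (A : Finset (ZMod N)) : 0 ≤ apDensity A := by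
  have h : ∀ n : ZMod N, 0 ≤ (A : Set (ZMod N)).indicator (1 : ZMod N → ℝ) n := fun n =>
    Set.indicator_nonneg (fun _ _ => zero_le_one) n
  refine div_nonneg (Finset.sum_nonneg fun n _ => Finset.sum_nonneg fun d _ => ?_) (by positivity)
  exact mul_nonneg (mul_nonneg (mul_nonneg (h _) (h _)) (h _)) (h _)

/-- The set whose supremum is `ρ₄(α)` is non-empty. -/
theorem zero_mem_admissible (α : ℝ) : (0 : ℝ) ∈ admissible α := by
  intro ε hε
  refine ⟨1, one_pos, 0, fun N _ _ A _ _ => ?_⟩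
  linarith [apDensity_nonneg A]

/-- The set whose supremum is `ρ₄(α)` is bounded above, so that the supremum is a genuine one. -/
theorem bddAbove_admissible {α : ℝ} (hα : 0 < α) : BddAbove (admissible α) := by
  refine ⟨α, fun c hc => ?_⟩
  obtain ⟨η, hη, N₀, h⟩ := hc α hα
  have h1 := h (N₀ + 1) (Nat.le_succ _) ∅ (fun r _ => by simpa [fourier] using hη.le) (by simp)
  have h2 : apDensity (∅ : Finset (ZMod (N₀ + 1))) = 0 := by simp [apDensity, Lambda]
  linarith

end FourAP

/-! The squares `x₀, …, x₃` of a four-term progression modulo an odd prime `p` satisfy `x₀ - 3x₁ +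
3x₂ - x₃ = 0`, and by Gauss sums they are equidistributed on that hyperplane. Hence a set `{u : u² ∈
I}`, with `I` an interval, is Fourier uniform, and its progressions are counted by solutions of a
linear equation in intervals. The intervals may also move with the term.

A coordinate `v ∈ ℤ/mℤ`, with `m = 13^(3k)`, moves them. For each `i < k` take a new large prime `p`
and let `I` have length about `p/13` and start near `5pv³/13^(3i+1)`. Along a progression in `v` of
difference `d = 13^i u` with `13 ∤ u`, the third difference of the starting points is about
`-30u³p/13` modulo `p`. Nonzero cubes modulo 13 are `±1, ±5`, so this lies at least `4p/13` away
from 0, whereas offsets inside the intervals contribute less than `4p/13`. So no progression has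
such a difference. For other `d` the density of progressions is at most about `13⁻³/3`, the `1/3`
coming from the coefficient 3 in the hyperplane.

Multiply the `k` sets by the Chinese remainder theorem. The density is about `13^(-k)`, and only the
differences divisible by `13^k`, a proportion `13^(-k)`, survive; the progression density is at most
`(7/20 · 13⁻⁴)^k`, with `7/20` replacing `1/3` to absorb errors. As `4 + log₁₃(20/7) > 4.407`, this
beats every exponent required. An unconstrained extra factor tunes the density between consecutive
powers of `1/13`. -/

namespace FourAP

open Finset Filter Topology

/-! ### Gauss sums in one and two variables. -/

section GaussSum

variable {p : ℕ} [Fact p.Prime]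

theorem sum_stdAddChar_mul (a : ZMod p) :
    ∑ x : ZMod p, ZMod.stdAddChar (a * x) = if a = 0 then (p : ℂ) else 0 := by
  have h := AddChar.sum_mulShift (ψ := ZMod.stdAddChar (N := p)) a (ZMod.isPrimitive_stdAddChar p)
  simp only [ZMod.card] at h
  rw [← Fintype.sum_congr _ _ fun x => by rw [mul_comm]]
  rw [h]
  split_ifs <;> simp

theorem two_ne_zero_of_ne_two (hp : p ≠ 2) : (2 : ZMod p) ≠ 0 := by
  intro h
  have h' : ((2 : ℕ) : ZMod p) = 0 := by exact_mod_cast h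
  rw [ZMod.natCast_eq_zero_iff] at h'
  exact hp ((Nat.prime_dvd_prime_iff_eq Fact.out Nat.prime_two).1 h')

/-- A quadratic exponential sum modulo an odd prime, twisted by any additive character, has
absolute value at most `√p`. -/
theorem norm_quadratic_sum_le (hp : p ≠ 2) {a : ZMod p} (ha : a ≠ 0) (χ : AddChar (ZMod p) ℂ) :
    ‖∑ u : ZMod p, ZMod.stdAddChar (a * u ^ 2) * χ u‖ ≤ √p := by
  set S : ℂ := ∑ u : ZMod p, ZMod.stdAddChar (a * u ^ 2) * χ u with hS
  have h2 := two_ne_zero_of_ne_two hp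
  have key : S * (starRingEnd ℂ) S = p := by
    rw [hS, map_sum, Finset.sum_mul_sum, Finset.sum_comm]
    have h1 : ∀ w : ZMod p, ∑ u : ZMod p, ZMod.stdAddChar (a * u ^ 2) * χ u *
        (starRingEnd ℂ) (ZMod.stdAddChar (a * w ^ 2) * χ w) =
        ∑ h : ZMod p, ZMod.stdAddChar (a * h ^ 2) * χ h * ZMod.stdAddChar ((2 * a * h) * w) := by
      intro w
      -- Weyl differencing: with `u = h + w` the phase becomes linear in `w`, and the sum over `w`
      -- leaves only `h = 0`.
      rw [← Equiv.sum_comp (Equiv.addRight w)]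
      refine Fintype.sum_congr _ _ fun h => ?_
      rw [map_mul (starRingEnd ℂ), ← AddChar.map_neg_eq_conj, ← AddChar.map_neg_eq_conj,
        Equiv.coe_addRight, mul_mul_mul_comm, ← AddChar.map_add_eq_mul, ← AddChar.map_add_eq_mul,
        mul_right_comm, ← AddChar.map_add_eq_mul]
      congr 2 <;> ring
    rw [Fintype.sum_congr _ _ h1, Finset.sum_comm]
    simp_rw [← Finset.mul_sum, sum_stdAddChar_mul]
    rw [Finset.sum_eq_single 0]
    · simp
    · intro h _ hh
      simp [h2, ha, hh]
    · simp
  have h3 : ‖S‖ ^ 2 = p := by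
    rw [Complex.mul_conj, Complex.normSq_eq_norm_sq] at key
    exact_mod_cast key
  rw [← h3, Real.sqrt_sq (norm_nonneg _)]

/-- Exponential sums of nonzero binary quadratic forms save a factor `√p`. -/
theorem norm_binary_quadratic_sum_le (hp : p ≠ 2) {a b c : ZMod p}
    (h : ¬ (a = 0 ∧ b = 0 ∧ c = 0)) :
    ‖∑ u : ZMod p, ∑ d : ZMod p, ZMod.stdAddChar (a * u ^ 2 + 2 * b * u * d + c * d ^ 2)‖
      ≤ p * √p := by
  have h2 := two_ne_zero_of_ne_two hp
  -- With a nonzero square coefficient, the one-variable bound applies for each value of the other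
  -- variable. If both square coefficients vanish, the cross term sums to exactly `p`.
  have one (a b c : ZMod p) (ha : a ≠ 0) :
      ‖∑ u : ZMod p, ∑ d : ZMod p, ZMod.stdAddChar (a * u ^ 2 + 2 * b * u * d + c * d ^ 2)‖
      ≤ p * √p := by
    rw [Finset.sum_comm]
    refine (norm_sum_le _ _).trans ((Finset.sum_le_card_nsmul _ _ (√p) fun d _ => ?_).trans ?_)
    · have : ∀ u : ZMod p, ZMod.stdAddChar (a * u ^ 2 + 2 * b * u * d + c * d ^ 2) =
          ZMod.stdAddChar (a * u ^ 2) * (AddChar.mulShift ZMod.stdAddChar (2 * b * d)) u *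
            ZMod.stdAddChar (c * d ^ 2) := by
        intro u
        rw [AddChar.mulShift_apply, ← AddChar.map_add_eq_mul, ← AddChar.map_add_eq_mul]
        ring_nf
      rw [Fintype.sum_congr _ _ this, ← Finset.sum_mul, norm_mul, AddChar.norm_apply, mul_one]
      exact norm_quadratic_sum_le hp ha _
    · simp
  by_cases ha : a = 0
  · by_cases hc : c = 0
    · have hb : b ≠ 0 := fun hb => h ⟨ha, hb, hc⟩
      subst ha hc
      simp only [zero_mul, zero_add, add_zero]
      simp_rw [sum_stdAddChar_mul]
      rw [Finset.sum_eq_single 0]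
      · simp only [mul_zero, if_true, Complex.norm_natCast]
        refine le_mul_of_one_le_right (Nat.cast_nonneg _) (Real.one_le_sqrt.2 ?_)
        exact_mod_cast (Fact.out : p.Prime).one_lt.le
      · intro u _ hu
        simp [h2, hb, hu]
      · simp
    · have := one c b a hc
      rw [Finset.sum_comm] at this
      refine le_of_eq_of_le ?_ this
      refine congrArg _ (Fintype.sum_congr _ _ fun u => Fintype.sum_congr _ _ fun d => ?_)
      ring_nf
  · exact one a b c ha

end GaussSum

/-! ### Fourier transforms of intervals. -/

section Interval

variable {p : ℕ} [NeZero p]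

/-- The indicator function of the interval `{s, s + 1, …, s + L - 1}` in `ℤ/pℤ`. -/
noncomputable def interval {p : ℕ} (s : ZMod p) (L : ℕ) (x : ZMod p) : ℝ :=
  if (x - s).val < L then 1 else 0

theorem sum_zmod_val {M : Type*} [AddCommMonoid M] (g : ℕ → M) :
    ∑ x : ZMod p, g x.val = ∑ i ∈ range p, g i := by
  refine Finset.sum_nbij ZMod.val (fun x _ => by simpa using ZMod.val_lt x)
    (fun x _ y _ h => ZMod.val_injective p h) (fun i hi => ?_) (fun _ _ => rfl)
  have hi' : i < p := by simpa using hi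
  exact ⟨(i : ZMod p), by simp, ZMod.val_cast_of_lt hi'⟩

theorem sum_val_lt {M : Type*} [AddCommMonoid M] (g : ℕ → M) {L : ℕ} (hL : L ≤ p) :
    ∑ x : ZMod p, (if x.val < L then g x.val else 0) = ∑ i ∈ range L, g i := by
  rw [sum_zmod_val fun i => if i < L then g i else 0, ← Finset.sum_filter]
  congr 1
  ext i
  simp only [mem_filter, mem_range]
  omega

/-- The normalised `ℓ¹`-norm of the discrete Fourier transform. -/
noncomputable def wiener (f : ZMod p → ℂ) : ℝ := (∑ k, ‖ZMod.dft f k‖) / p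

theorem eq_sum_dft (f : ZMod p → ℂ) (x : ZMod p) :
    f x = ∑ k, (ZMod.dft f k / p) * ZMod.stdAddChar (k * x) := by
  conv_lhs => rw [← ZMod.dft.symm_apply_apply f, ZMod.invDFT_apply]
  simp only [smul_eq_mul, Finset.mul_sum]
  refine Fintype.sum_congr _ _ fun k => ?_
  ring

/-- The left norm is `2|sin(πt/p)|`, bounded below by Jordan's inequality on the half of the circle
containing `t`. Adding the bounds for both halves avoids a minimum and sums to harmonic numbers. -/
theorem one_div_norm_stdAddChar_sub_one_le {t : ZMod p} (ht : t ≠ 0) :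
    1 / ‖ZMod.stdAddChar t - 1‖ ≤ p / 4 * (1 / (t.val : ℝ) + 1 / ((p : ℝ) - t.val)) := by
  have hp : (0 : ℝ) < p := by exact_mod_cast NeZero.pos p
  have hv : (0 : ℝ) < t.val := by
    exact_mod_cast Nat.pos_of_ne_zero (fun h => ht ((ZMod.val_eq_zero t).1 h))
  have hv' : (0 : ℝ) < (p : ℝ) - t.val := by
    have : (t.val : ℝ) < p := by exact_mod_cast ZMod.val_lt t
    linarith
  have h1 : ‖ZMod.stdAddChar t - 1‖ = 2 * |Real.sin (Real.pi * t.val / p)| := by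
    have : (ZMod.stdAddChar t : ℂ) = Complex.exp (Complex.I * ((2 * Real.pi * t.val / p : ℝ) : ℂ)) := by
      rw [ZMod.stdAddChar_apply, ZMod.toCircle_apply]
      push_cast
      ring_nf
    rw [this, Complex.norm_exp_I_mul_ofReal_sub_one, norm_mul]
    simp only [Real.norm_eq_abs, abs_two]
    ring_nf
  have low (y : ℝ) (hy : 0 ≤ y) (hyp : y ≤ p / 2) : 2 * y / p ≤ Real.sin (Real.pi * y / p) := by
    have h := Real.mul_le_sin (x := Real.pi * y / p) (by positivity) (by
      rw [div_le_div_iff₀ hp two_pos]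
      nlinarith [Real.pi_pos])
    refine le_trans (le_of_eq ?_) h
    field_simp
  rw [h1]
  rcases le_total (t.val : ℝ) (p / 2) with h | h
  · have h2 := low _ hv.le h
    calc 1 / (2 * |Real.sin (Real.pi * t.val / p)|) ≤ 1 / (2 * (2 * t.val / p)) := by
          have : 0 < 2 * (t.val : ℝ) / p := by positivity
          gcongr
          exact h2.trans (le_abs_self _)
      _ = p / 4 * (1 / (t.val : ℝ)) := by field_simp; norm_num
      _ ≤ _ := by
          gcongr
          have : 0 < 1 / ((p : ℝ) - t.val) := by positivity
          linarith
  · have h2 := low _ hv'.le (by linarith)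
    have h3 : Real.sin (Real.pi * ((p : ℝ) - t.val) / p) = Real.sin (Real.pi * t.val / p) := by
      rw [← Real.sin_pi_sub]
      congr 1
      field_simp
      ring
    rw [h3] at h2
    calc 1 / (2 * |Real.sin (Real.pi * t.val / p)|) ≤ 1 / (2 * (2 * ((p : ℝ) - t.val) / p)) := by
          have : 0 < 2 * ((p : ℝ) - t.val) / p := by positivity
          gcongr
          exact h2.trans (le_abs_self _)
      _ = p / 4 * (1 / ((p : ℝ) - t.val)) := by field_simp; norm_num
      _ ≤ _ := by
          gcongr
          have : 0 < 1 / (t.val : ℝ) := by positivity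
          linarith

theorem dft_interval (s : ZMod p) {L : ℕ} (hL : L ≤ p) (k : ZMod p) :
    ZMod.dft (fun x => (interval s L x : ℂ)) k =
      ZMod.stdAddChar (-(s * k)) * ∑ i ∈ range L, ZMod.stdAddChar (-k) ^ i := by
  rw [ZMod.dft_apply, ← Equiv.sum_comp (Equiv.addRight s), ← sum_val_lt _ hL, Finset.mul_sum]
  refine Fintype.sum_congr _ _ fun x => ?_
  simp only [interval, Equiv.coe_addRight, add_sub_cancel_right, smul_eq_mul]
  split_ifs
  · rw [← AddChar.map_nsmul_eq_pow, ← AddChar.map_add_eq_mul]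
    simp only [Complex.ofReal_one, mul_one, nsmul_eq_mul, ZMod.natCast_val, ZMod.cast_id', id]
    ring_nf
  · simp

/-- The transform is a geometric sum, so its `ℓ¹`-norm is controlled by a harmonic sum. Logarithmic
growth is what lets a saving of `√p` win. -/
theorem wiener_interval_le (s : ZMod p) {L : ℕ} (hL : L ≤ p) :
    wiener (fun x => (interval s L x : ℂ)) ≤ 2 + Real.log p := by
  have hp : (0 : ℝ) < p := by exact_mod_cast NeZero.pos p
  let g : ℕ → ℝ := fun i => if i = 0 then (p : ℝ) else p / 2 * (1 / (i : ℝ) + 1 / ((p : ℝ) - i))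
  have h1 : ∀ k : ZMod p, ‖ZMod.dft (fun x => (interval s L x : ℂ)) (-k)‖ ≤ g k.val := by
    intro k
    rw [dft_interval s hL, norm_mul, AddChar.norm_apply, one_mul, neg_neg]
    by_cases hk : k = 0
    · subst hk
      simp only [AddChar.map_zero_eq_one, one_pow, sum_const, card_range, nsmul_eq_mul, mul_one,
        Complex.norm_natCast, ZMod.val_zero, g, if_true]
      exact_mod_cast hL
    · have hv : k.val ≠ 0 := fun h => hk ((ZMod.val_eq_zero k).1 h)
      have hne : (ZMod.stdAddChar k : ℂ) ≠ 1 := by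
        intro h
        apply hk
        apply ZMod.injective_stdAddChar
        rw [h, AddChar.map_zero_eq_one]
      rw [geom_sum_eq hne, norm_div]
      have h2 : ‖(ZMod.stdAddChar k : ℂ) ^ L - 1‖ ≤ 2 := by
        refine (norm_sub_le _ _).trans ?_
        rw [norm_pow, AddChar.norm_apply]
        norm_num
      have h3 := one_div_norm_stdAddChar_sub_one_le hk
      simp only [g, hv, if_false]
      calc _ ≤ 2 * (1 / ‖(ZMod.stdAddChar k : ℂ) - 1‖) := by
            rw [mul_one_div]; gcongr
        _ ≤ _ := by linarith
  have h2 : ∑ k, ‖ZMod.dft (fun x => (interval s L x : ℂ)) k‖ ≤ ∑ i ∈ range p, g i := by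
    rw [← Equiv.sum_comp (Equiv.neg _), ← sum_zmod_val]
    exact Finset.sum_le_sum fun k _ => h1 k
  obtain ⟨q, hq⟩ := Nat.exists_eq_succ_of_ne_zero (NeZero.ne p)
  have hH : ∑ i ∈ range q, (1 / ((i + 1 : ℕ) : ℝ)) ≤ 1 + Real.log p := by
    have h := harmonic_le_one_add_log q
    have e : ((harmonic q : ℚ) : ℝ) = ∑ i ∈ range q, (1 / ((i + 1 : ℕ) : ℝ)) := by
      simp [harmonic]
    rw [← e]
    refine h.trans ?_
    rcases Nat.eq_zero_or_pos q with h0 | h0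
    · subst h0; simp [hq]
    · gcongr
      omega
  have h3 : ∑ i ∈ range p, g i ≤ p * (2 + Real.log p) := by
    have e1 : ∑ i ∈ range q, (1 / ((p : ℝ) - (i + 1 : ℕ))) = ∑ i ∈ range q, (1 / ((i + 1 : ℕ) : ℝ)) := by
      rw [← Finset.sum_range_reflect]
      refine Finset.sum_congr rfl fun i hi => ?_
      have hi' : i < q := by simpa using hi
      congr 1
      rw [hq, sub_eq_iff_eq_add]
      norm_cast
      omega
    have e2 : ∑ i ∈ range p, g i = p / 2 * (∑ i ∈ range q, (1 / ((i + 1 : ℕ) : ℝ)) +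
        ∑ i ∈ range q, (1 / ((p : ℝ) - (i + 1 : ℕ)))) + p := by
      conv_lhs => rw [hq, Finset.sum_range_succ']
      simp only [g, Nat.succ_ne_zero, if_false, if_true]
      rw [← Finset.mul_sum, Finset.sum_add_distrib]
    rw [e2, e1]
    nlinarith
  rw [wiener, div_le_iff₀ hp]
  linarith

end Interval

/-! ### Comparing averages through exponential sums. -/

section Comparison

variable {p : ℕ} [NeZero p]

theorem map_sum_eq_prod {ι A : Type*} [AddCommMonoid A] (ψ : AddChar A ℂ) (s : Finset ι)
    (f : ι → A) : ψ (∑ i ∈ s, f i) = ∏ i ∈ s, ψ (f i) := by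
  classical
  induction s using Finset.induction_on with
  | empty => simp
  | insert i s hi h => rw [Finset.sum_insert hi, Finset.prod_insert hi, AddChar.map_add_eq_mul, h]

theorem sum_prod_eq_sum_dft {ι X : Type*} [Fintype ι] [DecidableEq ι] [Fintype X]
    (f : ι → ZMod p → ℂ) (x : X → ι → ZMod p) :
    ∑ t, ∏ i, f i (x t i) = ∑ ξ : ι → ZMod p, (∏ i, ZMod.dft (f i) (ξ i) / p) *
      ∑ t, ZMod.stdAddChar (∑ i, ξ i * x t i) := by
  have h (t : X) : ∏ i, f i (x t i) = ∑ ξ : ι → ZMod p, (∏ i, ZMod.dft (f i) (ξ i) / p) *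
      ZMod.stdAddChar (∑ i, ξ i * x t i) := by
    rw [Finset.prod_congr rfl fun i _ => eq_sum_dft (f i) (x t i), Finset.prod_univ_sum,
      Fintype.piFinset_univ]
    refine Fintype.sum_congr _ _ fun ξ => ?_
    rw [Finset.prod_mul_distrib, map_sum_eq_prod]
  rw [Fintype.sum_congr _ _ h, Finset.sum_comm]
  simp_rw [Finset.mul_sum]

/-- If all exponential averages of two families of points of `(ℤ/pℤ)^ι` agree up to `B`, then the
averages of a product function over the two families agree up to `B` times the Wiener norms. -/
theorem norm_average_sub_average_le {ι X Y : Type*} [Fintype ι] [DecidableEq ι] [Fintype X]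
    [Fintype Y] (f : ι → ZMod p → ℂ) (x : X → ι → ZMod p) (y : Y → ι → ZMod p) (M M' : ℂ) {B : ℝ}
    (hB : ∀ ξ : ι → ZMod p, ‖(∑ t, ZMod.stdAddChar (∑ i, ξ i * x t i)) / M -
      (∑ t, ZMod.stdAddChar (∑ i, ξ i * y t i)) / M'‖ ≤ B) :
    ‖(∑ t, ∏ i, f i (x t i)) / M - (∑ t, ∏ i, f i (y t i)) / M'‖ ≤ (∏ i, wiener (f i)) * B := by
  rw [sum_prod_eq_sum_dft, sum_prod_eq_sum_dft, Finset.sum_div, Finset.sum_div,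
    ← Finset.sum_sub_distrib]
  refine (norm_sum_le _ _).trans ?_
  have e : ∏ i, wiener (f i) = ∑ ξ : ι → ZMod p, ‖∏ i, ZMod.dft (f i) (ξ i) / p‖ := by
    simp only [wiener, Finset.sum_div, Finset.prod_univ_sum, Fintype.piFinset_univ, norm_prod,
      norm_div, Complex.norm_natCast]
  rw [e, Finset.sum_mul]
  refine Finset.sum_le_sum fun ξ _ => ?_
  rw [mul_div_assoc, mul_div_assoc, ← mul_sub, norm_mul]
  gcongr
  exact hB ξ

end Comparison

/-! ### Equidistribution of squares. -/

section Quadratic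

variable {p : ℕ} [Fact p.Prime]

/-- Expand `f` in characters: frequency 0 gives the main term, and every other frequency gives a
twisted Gauss sum of size at most `√p`. -/
theorem norm_sum_quadratic_le (hp : p ≠ 2) (f : ZMod p → ℂ) (χ : AddChar (ZMod p) ℂ) :
    ‖(∑ u, f (u ^ 2) * χ u) / p - if χ = 0 then (∑ x, f x) / p else 0‖ ≤ wiener f / √p := by
  have hp0 : (0 : ℝ) < p := by exact_mod_cast (Fact.out : p.Prime).pos
  have h1 : ∑ u, f (u ^ 2) * χ u =
      ∑ k, (ZMod.dft f k / p) * ∑ u, ZMod.stdAddChar (k * u ^ 2) * χ u := by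
    simp_rw [Finset.mul_sum]
    rw [Finset.sum_comm]
    refine Fintype.sum_congr _ _ fun u => ?_
    conv_lhs => rw [eq_sum_dft f, Finset.sum_mul]
    simp_rw [mul_assoc]
  have h0 : (ZMod.dft f 0 / p) * ∑ u, ZMod.stdAddChar (0 * u ^ 2) * χ u =
      if χ = 0 then ∑ x, f x else 0 := by
    simp only [zero_mul, AddChar.map_zero_eq_one, one_mul, ZMod.dft_apply_zero]
    rw [AddChar.sum_eq_ite]
    have : (p : ℂ) ≠ 0 := by exact_mod_cast hp0.ne'
    split_ifs
    · simp only [ZMod.card]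
      field_simp
    · simp
  have h2 : (∑ u, f (u ^ 2) * χ u) / p - (if χ = 0 then (∑ x, f x) / p else 0) =
      (∑ k ∈ univ.erase 0, (ZMod.dft f k / p) * ∑ u, ZMod.stdAddChar (k * u ^ 2) * χ u) / p := by
    rw [h1, ← Finset.add_sum_erase _ _ (mem_univ (0 : ZMod p)), h0]
    split_ifs <;> ring
  rw [h2, norm_div, Complex.norm_natCast]
  have h3 : ‖∑ k ∈ univ.erase 0, (ZMod.dft f k / p) * ∑ u, ZMod.stdAddChar (k * u ^ 2) * χ u‖ ≤
      wiener f * √p := by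
    refine (norm_sum_le _ _).trans ?_
    calc ∑ k ∈ univ.erase 0, ‖(ZMod.dft f k / p) * ∑ u, ZMod.stdAddChar (k * u ^ 2) * χ u‖
        ≤ ∑ k ∈ univ.erase 0, ‖ZMod.dft f k‖ / p * √p := by
          refine Finset.sum_le_sum fun k hk => ?_
          rw [norm_mul, norm_div, Complex.norm_natCast]
          gcongr
          exact norm_quadratic_sum_le hp (Finset.ne_of_mem_erase hk) χ
      _ ≤ ∑ k, ‖ZMod.dft f k‖ / p * √p :=
          Finset.sum_le_sum_of_subset_of_nonneg (Finset.erase_subset _ _) fun _ _ _ => by positivity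
      _ = wiener f * √p := by rw [wiener, Finset.sum_div, Finset.sum_mul]
  calc _ ≤ wiener f * √p / p := by gcongr
    _ = wiener f / √p := by
      have := Real.mul_self_sqrt hp0.le
      have h : 0 < √(p : ℝ) := Real.sqrt_pos.2 hp0
      rw [div_eq_div_iff hp0.ne' h.ne', mul_assoc, this]

theorem sum_triple_stdAddChar (k l m : ZMod p) :
    ∑ t : ZMod p × ZMod p × ZMod p, ZMod.stdAddChar (k * t.1 + l * t.2.1 + m * t.2.2) =
      if k = 0 ∧ l = 0 ∧ m = 0 then (p : ℂ) ^ 3 else 0 := by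
  simp only [Fintype.sum_prod_type, AddChar.map_add_eq_mul, ← Finset.mul_sum, ← Finset.sum_mul,
    sum_stdAddChar_mul]
  by_cases hk : k = 0 <;> by_cases hl : l = 0 <;> by_cases hm : m = 0 <;> simp [hk, hl, hm]
  ring

/-- The squares of the terms of a random four-term progression modulo `p` are equidistributed on
the hyperplane `x₀ - 3 x₁ + 3 x₂ - x₃ = 0`. -/
theorem norm_square_progression_average_le (hp : p ≠ 2) (ξ : Fin 4 → ZMod p) :
    ‖(∑ t : ZMod p × ZMod p, ZMod.stdAddChar (∑ i, ξ i *
        ![t.1 ^ 2, (t.1 + t.2) ^ 2, (t.1 + 2 * t.2) ^ 2, (t.1 + 3 * t.2) ^ 2] i)) / (p : ℂ) ^ 2 -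
      (∑ t : ZMod p × ZMod p × ZMod p, ZMod.stdAddChar (∑ i, ξ i *
        ![t.1, t.2.1, t.2.2, t.1 - 3 * t.2.1 + 3 * t.2.2] i)) / (p : ℂ) ^ 3‖ ≤ 1 / √p := by
  have hp0 : (0 : ℝ) < p := by exact_mod_cast (Fact.out : p.Prime).pos
  have hpc : (p : ℂ) ≠ 0 := by exact_mod_cast hp0.ne'
  have h2 := two_ne_zero_of_ne_two hp
  have e1 : ∀ t : ZMod p × ZMod p, ∑ i, ξ i *
      ![t.1 ^ 2, (t.1 + t.2) ^ 2, (t.1 + 2 * t.2) ^ 2, (t.1 + 3 * t.2) ^ 2] i =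
      (ξ 0 + ξ 1 + ξ 2 + ξ 3) * t.1 ^ 2 + 2 * (ξ 1 + 2 * ξ 2 + 3 * ξ 3) * t.1 * t.2 +
        (ξ 1 + 4 * ξ 2 + 9 * ξ 3) * t.2 ^ 2 := by
    intro t
    simp [Fin.sum_univ_four]
    ring
  have e2 : ∀ t : ZMod p × ZMod p × ZMod p, ∑ i, ξ i *
      ![t.1, t.2.1, t.2.2, t.1 - 3 * t.2.1 + 3 * t.2.2] i =
      (ξ 0 + ξ 3) * t.1 + (ξ 1 - 3 * ξ 3) * t.2.1 + (ξ 2 + 3 * ξ 3) * t.2.2 := by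
    intro t
    simp [Fin.sum_univ_four]
    ring
  simp_rw [e1, e2]
  rw [sum_triple_stdAddChar, Fintype.sum_prod_type]
  -- For odd `p`, the quadratic form vanishes exactly when `ξ` is trivial on the hyperplane. Then
  -- both averages are 1; otherwise the second is 0 and the first is small.
  by_cases h : ξ 0 + ξ 1 + ξ 2 + ξ 3 = 0 ∧ ξ 1 + 2 * ξ 2 + 3 * ξ 3 = 0 ∧
      ξ 1 + 4 * ξ 2 + 9 * ξ 3 = 0
  · obtain ⟨ha, hb, hc⟩ := h
    have hm : ξ 2 + 3 * ξ 3 = 0 := by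
      have : 2 * (ξ 2 + 3 * ξ 3) = 0 := by linear_combination hc - hb
      exact (mul_eq_zero.1 this).resolve_left h2
    have hl : ξ 1 - 3 * ξ 3 = 0 := by linear_combination hb - 2 * hm
    have hk : ξ 0 + ξ 3 = 0 := by linear_combination ha - hl - hm
    simp only [ha, hb, hc, hk, hl, hm, zero_mul, mul_zero, add_zero, AddChar.map_zero_eq_one]
    have : (∑ _x : ZMod p, ∑ _y : ZMod p, (1 : ℂ)) = (p : ℂ) ^ 2 := by simp [sq]
    rw [this]
    simp [hpc]
  · have h' : ¬ (ξ 0 + ξ 3 = 0 ∧ ξ 1 - 3 * ξ 3 = 0 ∧ ξ 2 + 3 * ξ 3 = 0) := by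
      rintro ⟨hk, hl, hm⟩
      exact h ⟨by linear_combination hk + hl + hm, by linear_combination hl + 2 * hm,
        by linear_combination hl + 4 * hm⟩
    rw [if_neg h', zero_div, sub_zero, norm_div, norm_pow, Complex.norm_natCast]
    have := norm_binary_quadratic_sum_le hp h
    calc _ ≤ p * √p / (p : ℝ) ^ 2 := by gcongr
      _ = 1 / √p := by
        have h1 := Real.mul_self_sqrt hp0.le
        have h : 0 < √(p : ℝ) := Real.sqrt_pos.2 hp0
        rw [div_eq_div_iff (by positivity) h.ne', mul_assoc, h1]
        ring

theorem interval_progression_average_le (hp : p ≠ 2) (s₀ s₁ s₂ s₃ : ZMod p) {L : ℕ} (hL : L ≤ p) :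
    (∑ u, ∑ d, interval s₀ L (u ^ 2) * interval s₁ L ((u + d) ^ 2) *
      interval s₂ L ((u + 2 * d) ^ 2) * interval s₃ L ((u + 3 * d) ^ 2)) / (p : ℝ) ^ 2 ≤
    (∑ a, ∑ b, ∑ c, interval s₀ L a * interval s₁ L b * interval s₂ L c *
      interval s₃ L (a - 3 * b + 3 * c)) / (p : ℝ) ^ 3 + (2 + Real.log p) ^ 4 / √p := by
  have h := norm_average_sub_average_le
    (![fun x => (interval s₀ L x : ℂ), fun x => (interval s₁ L x : ℂ),
      fun x => (interval s₂ L x : ℂ), fun x => (interval s₃ L x : ℂ)]) _ _ ((p : ℂ) ^ 2)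
      ((p : ℂ) ^ 3) (norm_square_progression_average_le hp)
  simp only [Fin.prod_univ_four, Fintype.sum_prod_type, Matrix.cons_val] at h
  have hl : (0 : ℝ) ≤ Real.log p := Real.log_natCast_nonneg p
  have hw : ∀ s : ZMod p, 0 ≤ wiener fun x => (interval s L x : ℂ) := fun s => by
    unfold wiener; positivity
  have h2 : (wiener fun x => (interval s₀ L x : ℂ)) * (wiener fun x => (interval s₁ L x : ℂ)) *
      (wiener fun x => (interval s₂ L x : ℂ)) * (wiener fun x => (interval s₃ L x : ℂ)) ≤
      (2 + Real.log p) ^ 4 := by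
    calc _ ≤ (2 + Real.log p) * (2 + Real.log p) * (2 + Real.log p) * (2 + Real.log p) := by
          have := fun s : ZMod p => wiener_interval_le s hL
          have := hw s₀
          have := hw s₁
          have := hw s₂
          have := hw s₃
          gcongr <;> exact wiener_interval_le _ hL
      _ = _ := by ring
  have h3 := h.trans (mul_le_mul_of_nonneg_right h2 (by positivity))
  rw [mul_one_div] at h3
  norm_cast at h3
  rw [Real.norm_eq_abs] at h3
  have := (abs_le.1 h3).2
  push_cast at this
  linarith

end Quadratic

/-! ### Counting points of the hyperplane in a box. -/

section Counting

variable {p : ℕ} [NeZero p]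

/-- Measured from the first admissible `c`, the value `K + 3c` advances in steps of 3. It stays
below `L + 3L ≤ p`, so it never wraps around to re-enter the window. -/
theorem card_interval_pair_le (s K : ZMod p) {L : ℕ} (hL : 4 * L ≤ p) :
    (univ.filter fun c : ZMod p => (c - s).val < L ∧ (K + 3 * c).val < L).card ≤ (L + 2) / 3 := by
  set S := univ.filter fun c : ZMod p => (c - s).val < L ∧ (K + 3 * c).val < L with hS
  rcases S.eq_empty_or_nonempty with h | h
  · simp [h]
  obtain ⟨c₀, hc₀, hmin⟩ := Finset.exists_min_image S (fun c => (c - s).val) h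
  rw [← Finset.card_range ((L + 2) / 3)]
  refine Finset.card_le_card_of_injOn (fun c => (c - s).val - (c₀ - s).val) (fun c hc => ?_)
    (fun c hc c' hc' hcc => ?_)
  · have h1 := hmin c hc
    simp only [hS, coe_filter, mem_filter, mem_univ, true_and, Set.mem_ofPred_eq] at hc hc₀
    set t := (c - s).val - (c₀ - s).val with ht
    have e : K + 3 * c = (((K + 3 * c₀).val + 3 * t : ℕ) : ZMod p) := by
      have : (t : ZMod p) = (c - s) - (c₀ - s) := by
        rw [ht, Nat.cast_sub h1]; simp
      push_cast
      rw [this]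
      simp only [ZMod.natCast_val, ZMod.cast_id', id]
      ring
    have h2 := hc.2
    rw [e, ZMod.val_cast_of_lt (by omega)] at h2
    simp only [coe_range, Set.mem_Iio]
    omega
  · have h1 := hmin c hc
    have h2 := hmin c' hc'
    have : (c - s).val = (c' - s).val := by simp only at hcc; omega
    simpa using ZMod.val_injective p this

theorem sum_interval (s : ZMod p) {L : ℕ} (hL : L ≤ p) : ∑ x, interval s L x = L := by
  rw [← Equiv.sum_comp (Equiv.addRight s)]
  simp only [interval, Equiv.coe_addRight, add_sub_cancel_right]
  rw [sum_val_lt (fun _ => (1 : ℝ)) hL]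
  simp

theorem interval_nonneg {p : ℕ} (s : ZMod p) (L : ℕ) (x : ZMod p) : 0 ≤ interval s L x := by
  unfold interval; split_ifs <;> norm_num

theorem sum_interval_hyperplane_le (s₀ s₁ s₂ s₃ : ZMod p) {L : ℕ} (hL : 4 * L ≤ p) :
    ∑ a, ∑ b, ∑ c, interval s₀ L a * interval s₁ L b * interval s₂ L c *
      interval s₃ L (a - 3 * b + 3 * c) ≤ (L : ℝ) ^ 2 * ((L + 2) / 3) := by
  have hLp : L ≤ p := by omega
  have h1 (a b : ZMod p) : ∑ c, interval s₀ L a * interval s₁ L b * interval s₂ L c *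
      interval s₃ L (a - 3 * b + 3 * c) ≤
      interval s₀ L a * interval s₁ L b * (((L : ℝ) + 2) / 3) := by
    simp_rw [mul_assoc, ← Finset.mul_sum]
    refine mul_le_mul_of_nonneg_left (mul_le_mul_of_nonneg_left ?_ (interval_nonneg _ _ _))
      (interval_nonneg _ _ _)
    have h2 := card_interval_pair_le s₂ (a - 3 * b - s₃) hL
    have e : ∑ c, interval s₂ L c * interval s₃ L (a - 3 * b + 3 * c) =
        ((univ.filter fun c : ZMod p =>
          (c - s₂).val < L ∧ (a - 3 * b - s₃ + 3 * c).val < L).card : ℝ) := by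
      rw [Finset.card_filter, Nat.cast_sum]
      refine Fintype.sum_congr _ _ fun c => ?_
      have : a - 3 * b + 3 * c - s₃ = a - 3 * b - s₃ + 3 * c := by ring
      simp only [interval, this]
      split_ifs <;> simp_all
    rw [e]
    calc _ ≤ (((L + 2) / 3 : ℕ) : ℝ) := by exact_mod_cast h2
      _ ≤ _ := by simpa using (Nat.cast_div_le (α := ℝ) (m := L + 2) (n := 3))
  calc _ ≤ ∑ a, ∑ b, interval s₀ L a * interval s₁ L b * (((L : ℝ) + 2) / 3) :=
        Finset.sum_le_sum fun a _ => Finset.sum_le_sum fun b _ => h1 a b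
    _ = _ := by
        simp_rw [← Finset.sum_mul, ← Finset.mul_sum, sum_interval _ hLp, ← Finset.sum_mul,
          sum_interval _ hLp]
        ring

end Counting

/-! ### Fibred models, their products, and the resulting sets. -/

section Model

variable {m : ℕ} {R S : Type*} [CommRing R] [Fintype R] [CommRing S] [Fintype S]

/-- A family of subsets of `R` indexed by `ℤ/mℤ` (given by indicator functions), each of density
`δ` and Fourier uniform up to `η`, and whose density of four-term progressions lying above a
progression of `ℤ/mℤ` with difference `d` is at most `τ d`. -/
structure IsModel (f : ZMod m → R → ℝ) (δ η : ℝ) (τ : ZMod m → ℝ) : Prop where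
  zero_or_one : ∀ v u, f v u = 0 ∨ f v u = 1
  uniform : ∀ v (χ : AddChar R ℂ),
    ‖(∑ u, (f v u : ℂ) * χ u) / Fintype.card R - if χ = 0 then (δ : ℂ) else 0‖ ≤ η
  progression_le : ∀ v d, (∑ u, ∑ e, f v u * f (v + d) (u + e) * f (v + 2 * d) (u + 2 * e) *
    f (v + 3 * d) (u + 3 * e)) / (Fintype.card R : ℝ) ^ 2 ≤ τ d

namespace IsModel

variable {f : ZMod m → R → ℝ} {δ η : ℝ} {τ : ZMod m → ℝ}

theorem nonneg (h : IsModel f δ η τ) (v : ZMod m) (u : R) : 0 ≤ f v u := by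
  rcases h.zero_or_one v u with h | h <;> simp [h]

theorem le_one (h : IsModel f δ η τ) (v : ZMod m) (u : R) : f v u ≤ 1 := by
  rcases h.zero_or_one v u with h | h <;> simp [h]

theorem mono (h : IsModel f δ η τ) {η' : ℝ} (hη : η ≤ η') : IsModel f δ η' τ :=
  ⟨h.zero_or_one, fun v χ => (h.uniform v χ).trans hη, h.progression_le⟩

theorem norm_average_le_one (h : IsModel f δ η τ) (v : ZMod m) (χ : AddChar R ℂ) :
    ‖(∑ u, (f v u : ℂ) * χ u) / Fintype.card R‖ ≤ 1 := by
  have hR : (0 : ℝ) < Fintype.card R := by exact_mod_cast Fintype.card_pos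
  rw [norm_div, Complex.norm_natCast, div_le_one hR]
  refine (norm_sum_le _ _).trans ((Finset.sum_le_card_nsmul _ _ 1 fun u _ => ?_).trans ?_)
  · rw [norm_mul, AddChar.norm_apply, mul_one, Complex.norm_real, Real.norm_eq_abs,
      abs_of_nonneg (h.nonneg v u)]
    exact h.le_one v u
  · simp

theorem progression_nonneg (h : IsModel f δ η τ) (v d : ZMod m) :
    0 ≤ (∑ u, ∑ e, f v u * f (v + d) (u + e) * f (v + 2 * d) (u + 2 * e) *
    f (v + 3 * d) (u + 3 * e)) / (Fintype.card R : ℝ) ^ 2 := by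
  refine div_nonneg (Finset.sum_nonneg fun u _ => Finset.sum_nonneg fun e _ => ?_) (by positivity)
  have := h.nonneg
  have h0 := this v u
  have h1 := this (v + d) (u + e)
  have h2 := this (v + 2 * d) (u + 2 * e)
  have h3 := this (v + 3 * d) (u + 3 * e)
  positivity

theorem comp_ringEquiv (h : IsModel f δ η τ) (e : S ≃+* R) :
    IsModel (fun v x => f v (e x)) δ η τ := by
  have hc : Fintype.card S = Fintype.card R := Fintype.card_congr e.toEquiv
  refine ⟨fun v u => h.zero_or_one v _, fun v χ => ?_, fun v d => ?_⟩
  · have := h.uniform v (χ.compAddMonoidHom (e.symm : R →+ S))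
    have h0 : χ.compAddMonoidHom (e.symm : R →+ S) = 0 ↔ χ = 0 := by
      simp only [AddChar.ext_iff, AddChar.compAddMonoidHom_apply, AddChar.zero_apply]
      exact ⟨fun H x => by simpa using H (e x), fun H x => H _⟩
    rw [← Equiv.sum_comp e.toEquiv, ← hc] at this
    simpa [h0] using this
  · have := h.progression_le v d
    rw [← Equiv.sum_comp e.toEquiv, ← hc] at this
    refine le_of_eq_of_le ?_ this
    congr 1
    refine Fintype.sum_congr _ _ fun u => ?_
    rw [← Equiv.sum_comp e.toEquiv]
    have h2 : e 2 = 2 := map_ofNat e 2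
    have h3 : e 3 = 3 := map_ofNat e 3
    simp [h2, h3]

/-- Characters of `R × S` factor, so Fourier errors add. For fixed `v` and `d` the progression
averages also factor, so the bounds multiply pointwise in `d`; this lets different factors kill
different `d`. -/
theorem mul (hf : IsModel f δ η τ) {g : ZMod m → S → ℝ} {δ' η' : ℝ} {τ' : ZMod m → ℝ}
    (hg : IsModel g δ' η' τ') (hδ : |δ| ≤ 1) :
    IsModel (fun v (x : R × S) => f v x.1 * g v x.2) (δ * δ') (η + η')
      (fun d => τ d * τ' d) := by
  refine ⟨fun v u => ?_, fun v χ => ?_, fun v d => ?_⟩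
  · rcases hf.zero_or_one v u.1 with h | h <;> rcases hg.zero_or_one v u.2 with h' | h' <;>
      simp [h, h']
  · set χ₁ := χ.compAddMonoidHom (AddMonoidHom.inl R S) with h1
    set χ₂ := χ.compAddMonoidHom (AddMonoidHom.inr R S) with h2
    have hχ (x : R) (y : S) : χ (x, y) = χ₁ x * χ₂ y := by
      simp [h1, h2, ← AddChar.map_add_eq_mul]
    have h0 : χ = 0 ↔ χ₁ = 0 ∧ χ₂ = 0 := by
      constructor
      · rintro rfl
        constructor <;> ext <;> simp [h1, h2]
      · rintro ⟨h1, h2⟩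
        ext ⟨x, y⟩
        simp [hχ, h1, h2]
    have e : (∑ x : R × S, ((f v x.1 * g v x.2 : ℝ) : ℂ) * χ x) / Fintype.card (R × S) =
        ((∑ u, (f v u : ℂ) * χ₁ u) / Fintype.card R) *
        ((∑ u, (g v u : ℂ) * χ₂ u) / Fintype.card S) := by
      rw [div_mul_div_comm, Fintype.card_prod, Nat.cast_mul, Finset.sum_mul_sum,
        Fintype.sum_prod_type]
      congr 1
      refine Fintype.sum_congr _ _ fun x => Fintype.sum_congr _ _ fun y => ?_
      rw [hχ]
      push_cast
      ring
    have e' : (if χ = 0 then ((δ * δ' : ℝ) : ℂ) else 0) =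
        (if χ₁ = 0 then (δ : ℂ) else 0) * (if χ₂ = 0 then (δ' : ℂ) else 0) := by
      by_cases a : χ₁ = 0 <;> by_cases b : χ₂ = 0 <;> simp [h0, a, b]
    rw [e, e']
    have A := hf.uniform v χ₁
    have B := hg.uniform v χ₂
    have C := hg.norm_average_le_one v χ₂
    have D : ‖(if χ₁ = 0 then (δ : ℂ) else 0)‖ ≤ 1 := by
      split_ifs
      · simpa using hδ
      · simp
    generalize (∑ u, (f v u : ℂ) * χ₁ u) / Fintype.card R = a at *
    generalize (∑ u, (g v u : ℂ) * χ₂ u) / Fintype.card S = b at *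
    generalize (if χ₁ = 0 then (δ : ℂ) else 0) = a' at *
    generalize (if χ₂ = 0 then (δ' : ℂ) else 0) = b' at *
    calc ‖a * b - a' * b'‖ = ‖(a - a') * b + a' * (b - b')‖ := by ring_nf
      _ ≤ ‖a - a'‖ * ‖b‖ + ‖a'‖ * ‖b - b'‖ := by
        refine (norm_add_le _ _).trans ?_
        rw [norm_mul, norm_mul]
      _ ≤ η * 1 + 1 * η' := by
        have : 0 ≤ η := (norm_nonneg _).trans A
        gcongr
      _ = η + η' := by ring
  · have A := hf.progression_le v d
    have B := hg.progression_le v d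
    have := mul_le_mul A B (hg.progression_nonneg v d) ((hf.progression_nonneg v d).trans A)
    refine le_of_eq_of_le ?_ this
    rw [div_mul_div_comm, Fintype.card_prod, Nat.cast_mul, mul_pow, Finset.sum_mul_sum,
      Fintype.sum_prod_type]
    congr 1
    refine Fintype.sum_congr _ _ fun x => Fintype.sum_congr _ _ fun y => ?_
    rw [Fintype.sum_prod_type, Finset.sum_mul_sum]
    refine Fintype.sum_congr _ _ fun x' => Fintype.sum_congr _ _ fun y' => ?_
    simp only [Prod.fst_add, Prod.snd_add, Prod.fst_mul, Prod.snd_mul, Prod.fst_ofNat,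
      Prod.snd_ofNat]
    ring

/-- A model over `ℤ/Qℤ`, with `Q` coprime to `m`, gives a Fourier uniform subset of
`ℤ/(mQ)ℤ`. -/
theorem exists_finset {Q : ℕ} [NeZero m] [NeZero Q] [NeZero (m * Q)] (hmQ : m.Coprime Q)
    {f : ZMod m → ZMod Q → ℝ} (h : IsModel f δ η τ) :
    ∃ A : Finset (ZMod (m * Q)), FourierUniform η A ∧
      |(A.card : ℝ) / (m * Q : ℕ) - δ| ≤ η ∧ apDensity A ≤ (∑ d, τ d) / m := by
  classical
  set e := ZMod.chineseRemainder hmQ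
  have hm : (0 : ℝ) < m := by exact_mod_cast NeZero.pos m
  have hmc : (m : ℂ) ≠ 0 := by exact_mod_cast hm.ne'
  set g : ZMod (m * Q) → ℝ := fun n => f (e n).1 (e n).2 with hg
  set A : Finset (ZMod (m * Q)) := univ.filter fun n => g n = 1 with hA
  have ind : ∀ n, (A : Set (ZMod (m * Q))).indicator (1 : ZMod (m * Q) → ℝ) n = g n := by
    intro n
    simp only [Set.indicator_apply, hA, coe_filter, mem_univ, true_and, Set.mem_ofPred_eq,
      Pi.one_apply]
    rcases h.zero_or_one (e n).1 (e n).2 with h | h <;> simp [hg, h]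
  have indc : ∀ n, (A : Set (ZMod (m * Q))).indicator (1 : ZMod (m * Q) → ℂ) n = (g n : ℂ) := by
    intro n
    rw [← ind n]
    simp only [Set.indicator_apply]
    split_ifs <;> simp
  have key : ∀ χ : AddChar (ZMod (m * Q)) ℂ,
      ‖(∑ n, (g n : ℂ) * χ n) / (m * Q : ℕ) - if χ = 0 then (δ : ℂ) else 0‖ ≤ η := by
    intro χ
    set χ' := χ.compAddMonoidHom (e.symm : ZMod m × ZMod Q →+ ZMod (m * Q)) with h'
    set χ₁ := χ'.compAddMonoidHom (AddMonoidHom.inl _ _) with h1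
    set χ₂ := χ'.compAddMonoidHom (AddMonoidHom.inr _ _) with h2
    have hχ (x : ZMod m) (y : ZMod Q) : χ (e.symm (x, y)) = χ₁ x * χ₂ y := by
      have : χ (e.symm (x, y)) = χ' (x, y) := rfl
      simp [this, h1, h2, ← AddChar.map_add_eq_mul]
    have h0 : χ = 0 ↔ χ₁ = 0 ∧ χ₂ = 0 := by
      constructor
      · rintro rfl
        constructor <;> ext <;> simp [h1, h2, h']
      · rintro ⟨h1, h2⟩
        ext x
        obtain ⟨⟨a, b⟩, rfl⟩ := e.symm.surjective x
        simp [hχ, h1, h2]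
    have e1 : (∑ n, (g n : ℂ) * χ n) / (m * Q : ℕ) =
        (∑ v, χ₁ v * ((∑ u, (f v u : ℂ) * χ₂ u) / Fintype.card (ZMod Q))) / m := by
      rw [← Equiv.sum_comp e.symm.toEquiv, Fintype.sum_prod_type, ZMod.card]
      simp_rw [← mul_div_assoc]
      rw [← Finset.sum_div, div_div, Nat.cast_mul, mul_comm (Q : ℂ)]
      congr 1
      refine Fintype.sum_congr _ _ fun v => ?_
      rw [Finset.mul_sum]
      refine Fintype.sum_congr _ _ fun u => ?_
      have : (χ (e.symm.toEquiv (v, u)) : ℂ) = χ₁ v * χ₂ u := hχ v u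
      rw [this]
      simp [hg]
      ring
    -- All fibres share the density `δ`, so the main terms cancel when `χ₂` is trivial and `χ₁` is
    -- not.
    have e2 : (if χ = 0 then (δ : ℂ) else 0) =
        (∑ v, χ₁ v * (if χ₂ = 0 then (δ : ℂ) else 0)) / m := by
      rw [← Finset.sum_mul, AddChar.sum_eq_ite]
      by_cases a : χ₁ = 0 <;> by_cases b : χ₂ = 0 <;> simp [h0, a, b, hmc]
    rw [e1, e2, ← sub_div, ← Finset.sum_sub_distrib, norm_div, Complex.norm_natCast,
      div_le_iff₀ hm]
    refine (norm_sum_le _ _).trans ((Finset.sum_le_card_nsmul _ _ η fun v _ => ?_).trans ?_)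
    · rw [← mul_sub, norm_mul, AddChar.norm_apply, one_mul]
      exact h.uniform v χ₂
    · simp [mul_comm]
  refine ⟨A, fun r hr => ?_, ?_, ?_⟩
  · have := key (AddChar.mulShift ZMod.stdAddChar (-r))
    rw [if_neg, sub_zero] at this
    · simpa [fourier, indc] using this
    · have := ZMod.isPrimitive_stdAddChar (m * Q) (neg_ne_zero.2 hr)
      rwa [AddChar.one_eq_zero] at this
  · have := key 0
    have e1 : (A.card : ℝ) = ∑ n, g n := by
      simp_rw [← ind]
      simp [Set.indicator_apply]
    have e2 : (∑ n, (g n : ℂ) * (0 : AddChar (ZMod (m * Q)) ℂ) n) / (m * Q : ℕ) -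
        (if (0 : AddChar (ZMod (m * Q)) ℂ) = 0 then (δ : ℂ) else 0) =
        (((A.card : ℝ) / (m * Q : ℕ) - δ : ℝ) : ℂ) := by
      rw [e1]; simp
    rw [e2, Complex.norm_real, Real.norm_eq_abs] at this
    exact this
  · rw [apDensity, Lambda]
    simp_rw [ind]
    have e1 : (∑ n, ∑ d, g n * g (n + d) * g (n + 2 * d) * g (n + 3 * d)) /
        ((m * Q : ℕ) : ℝ) ^ 2 = (∑ v, ∑ d, (∑ u, ∑ e, f v u * f (v + d) (u + e) *
          f (v + 2 * d) (u + 2 * e) * f (v + 3 * d) (u + 3 * e)) /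
            (Fintype.card (ZMod Q) : ℝ) ^ 2) / (m : ℝ) ^ 2 := by
      rw [← Equiv.sum_comp e.symm.toEquiv, Fintype.sum_prod_type, ZMod.card]
      simp_rw [← Finset.sum_div]
      rw [div_div, Nat.cast_mul, mul_pow, mul_comm ((Q : ℝ) ^ 2)]
      congr 1
      refine Fintype.sum_congr _ _ fun v => ?_
      rw [Finset.sum_comm]
      rw [← Equiv.sum_comp e.symm.toEquiv, Fintype.sum_prod_type]
      refine Fintype.sum_congr _ _ fun d => ?_
      rw [Finset.sum_comm]
      refine Fintype.sum_congr _ _ fun u => Fintype.sum_congr _ _ fun x => ?_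
      have h2 : e 2 = 2 := map_ofNat e 2
      have h3 : e 3 = 3 := map_ofNat e 3
      simp [hg, h2, h3]
    rw [e1]
    calc _ ≤ (∑ _v : ZMod m, ∑ d, τ d) / (m : ℝ) ^ 2 := by
          gcongr
          exact h.progression_le _ _
      _ = _ := by
          simp only [sum_const, card_univ, ZMod.card, nsmul_eq_mul]
          field_simp

end IsModel

end Model

/-! ### Models from moving intervals. -/

theorem tendsto_log_pow_div_sqrt :
    Tendsto (fun p : ℕ => (2 + Real.log p) ^ 4 / √(p : ℝ)) atTop (𝓝 0) := by
  have h : (fun x : ℝ => 2 + Real.log x) =o[atTop] fun x : ℝ => x ^ (1 / 8 : ℝ) := by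
    refine Asymptotics.IsLittleO.add ?_ (isLittleO_log_rpow_atTop (by norm_num))
    rw [Asymptotics.isLittleO_const_left]
    right
    exact tendsto_norm_atTop_atTop.comp (tendsto_rpow_atTop (by norm_num))
  have h4 := (h.pow (n := 4) (by norm_num)).tendsto_div_nhds_zero
  refine (h4.comp tendsto_natCast_atTop_atTop).congr fun p => ?_
  simp only [Function.comp_apply]
  rw [← Real.rpow_natCast, ← Real.rpow_natCast, ← Real.rpow_mul (Nat.cast_nonneg p),
    Real.sqrt_eq_rpow]
  norm_num

theorem log_div_sqrt_le (p : ℕ) : (2 + Real.log p) / √(p : ℝ) ≤ (2 + Real.log p) ^ 4 / √(p : ℝ) := by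
  have : 1 ≤ 2 + Real.log p := by linarith [Real.log_natCast_nonneg p]
  gcongr
  exact le_self_pow₀ this (by norm_num)

theorem interval_zero_or_one {p : ℕ} (s : ZMod p) (L : ℕ) (x : ZMod p) :
    interval s L x = 0 ∨ interval s L x = 1 := by
  unfold interval; split_ifs <;> simp

theorem isModel_interval {m p : ℕ} [Fact p.Prime] (hp : p ≠ 2) (s : ZMod m → ZMod p) {L : ℕ}
    (hL : L ≤ p) (δ : ℝ) {τ : ZMod m → ℝ}
    (hτ : ∀ v d, (∑ u, ∑ e, interval (s v) L (u ^ 2) * interval (s (v + d)) L ((u + e) ^ 2) *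
      interval (s (v + 2 * d)) L ((u + 2 * e) ^ 2) *
      interval (s (v + 3 * d)) L ((u + 3 * e) ^ 2)) / (p : ℝ) ^ 2 ≤ τ d) :
    IsModel (fun v u => interval (s v) L (u ^ 2)) δ
      (|(L : ℝ) / p - δ| + (2 + Real.log p) / √p) τ := by
  refine ⟨fun v u => interval_zero_or_one _ _ _, fun v χ => ?_, fun v d => ?_⟩
  · have h := norm_sum_quadratic_le hp (fun x => (interval (s v) L x : ℂ)) χ
    have hw := wiener_interval_le (s v) hL
    have e : ∑ x, (interval (s v) L x : ℂ) = L := by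
      rw [← Complex.ofReal_sum, sum_interval _ hL]; simp
    rw [e] at h
    rw [ZMod.card]
    set a : ℂ := (∑ u, (interval (s v) L (u ^ 2) : ℂ) * χ u) / p
    have h' : ‖(if χ = 0 then (L : ℂ) / p else 0) - (if χ = 0 then (δ : ℂ) else 0)‖ ≤
        |(L : ℝ) / p - δ| := by
      split_ifs
      · rw [← Real.norm_eq_abs, ← Complex.norm_real]
        simp
      · simp
    calc _ ≤ ‖a - if χ = 0 then (L : ℂ) / p else 0‖ +
          ‖(if χ = 0 then (L : ℂ) / p else 0) - (if χ = 0 then (δ : ℂ) else 0)‖ :=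
          norm_sub_le_norm_sub_add_norm_sub _ _ _
      _ ≤ (2 + Real.log p) / √p + |(L : ℝ) / p - δ| := by
          gcongr
          exact h.trans (by gcongr)
      _ = _ := add_comm _ _
  · simpa only [ZMod.card] using hτ v d

theorem abs_floor_div_sub_le {p : ℕ} (hp : 0 < p) {t : ℝ} (ht : 0 ≤ t) :
    |((⌊t * p⌋₊ : ℕ) : ℝ) / p - t| ≤ 1 / p := by
  have hp' : (0 : ℝ) < p := by exact_mod_cast hp
  have h1 := Nat.floor_le (a := t * p) (by positivity)
  have h2 := Nat.lt_floor_add_one (t * p)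
  rw [div_sub' hp'.ne', abs_div, abs_of_pos hp']
  gcongr
  rw [abs_le]
  constructor <;> linarith

/-- Models without progression constraint, of arbitrary density. -/
theorem exists_isModel_of_density (m : ℕ) {δ : ℝ} (hδ : 0 ≤ δ) (hδ' : δ ≤ 1) {η : ℝ} (hη : 0 < η)
    (B : ℕ) : ∃ (p : ℕ) (_ : NeZero p) (f : ZMod m → ZMod p → ℝ),
      p.Prime ∧ B < p ∧ IsModel f δ η (fun _ => 1) := by
  have e1 := tendsto_log_pow_div_sqrt.eventually (gt_mem_nhds (half_pos hη))
  have e2 := (tendsto_one_div_atTop_nhds_zero_nat (𝕜 := ℝ)).eventually (gt_mem_nhds (half_pos hη))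
  obtain ⟨n, hn⟩ := eventually_atTop.1 (e1.and e2)
  obtain ⟨p, hp, hpp⟩ := Nat.exists_infinite_primes (n + B + 3)
  obtain ⟨h1, h2⟩ := hn p (by omega)
  have : Fact p.Prime := ⟨hpp⟩
  have hp0 : (0 : ℝ) < p := by exact_mod_cast hpp.pos
  have hL : ⌊δ * p⌋₊ ≤ p := by
    refine Nat.floor_le_of_le ?_
    nlinarith
  have hmod := isModel_interval (m := m) (p := p) (by omega) (fun _ => 0) hL δ (τ := fun _ => 1)
    (fun v d => by
      rw [div_le_one (by positivity)]
      calc _ ≤ ∑ _u : ZMod p, ∑ _e : ZMod p, (1 : ℝ) := by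
            refine Finset.sum_le_sum fun u _ => Finset.sum_le_sum fun e _ => ?_
            have h (s x : ZMod p) : 0 ≤ interval s ⌊δ * p⌋₊ x ∧ interval s ⌊δ * p⌋₊ x ≤ 1 := by
              rcases interval_zero_or_one s ⌊δ * p⌋₊ x with h | h <;> simp [h]
            refine mul_le_one₀ (mul_le_one₀ (mul_le_one₀ (h _ _).2 (h _ _).1 (h _ _).2)
              (h _ _).1 (h _ _).2) (h _ _).1 (h _ _).2
        _ = _ := by simp [sq])
  refine ⟨p, inferInstance, _, hpp, by omega, hmod.mono ?_⟩
  have := abs_floor_div_sub_le hpp.pos hδ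
  have := log_div_sqrt_le p
  linarith

/-! ### The cubic obstruction modulo 13. -/

section Cubic

/-- As `-30 ≡ -4` and nonzero cubes are `±1, ±5` modulo 13, the residues are `±4, ±6`. -/
theorem four_le_abs_cube {u : ℤ} (hu : ¬ (13 : ℤ) ∣ u) (t : ℤ) : 4 ≤ |-30 * u ^ 3 + 13 * t| := by
  have h : u ^ 3 % 13 = 1 ∨ u ^ 3 % 13 = 5 ∨ u ^ 3 % 13 = 8 ∨ u ^ 3 % 13 = 12 := by
    have h1 : u % 13 ≠ 0 := fun h => hu (Int.dvd_of_emod_eq_zero h)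
    have h2 : 0 ≤ u % 13 := Int.emod_nonneg _ (by norm_num)
    have h3 : u % 13 < 13 := Int.emod_lt_of_pos _ (by norm_num)
    rw [((Int.mod_modEq u 13).pow 3).symm.eq]
    generalize u % 13 = r at *
    interval_cases r <;> simp_all
  rw [le_abs]
  omega

/-- Third differences of `x ↦ 5 x³`, modulo `13^(3i+1)`, along differences exactly divisible by
`13^i`. -/
theorem exists_third_difference {i : ℕ} {x₀ x₁ x₂ x₃ d : ℤ}
    (h₁ : (13 : ℤ) ^ (3 * i + 1) ∣ x₁ - (x₀ + d)) (h₂ : (13 : ℤ) ^ (3 * i + 1) ∣ x₂ - (x₀ + 2 * d))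
    (h₃ : (13 : ℤ) ^ (3 * i + 1) ∣ x₃ - (x₀ + 3 * d)) (hd : (13 : ℤ) ^ i ∣ d)
    (hd' : ¬ (13 : ℤ) ^ (i + 1) ∣ d) :
    ∃ w : ℤ, 5 * x₀ ^ 3 - 3 * (5 * x₁ ^ 3) + 3 * (5 * x₂ ^ 3) - 5 * x₃ ^ 3 =
      13 ^ (3 * i) * w ∧ ∀ y, 4 ≤ |w - 13 * y| := by
  obtain ⟨u, rfl⟩ := hd
  have hu : ¬ (13 : ℤ) ∣ u := fun h => hd' (by rw [pow_succ]; exact mul_dvd_mul_left _ h)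
  obtain ⟨a, ha⟩ := h₁
  obtain ⟨b, hb⟩ := h₂
  obtain ⟨c, hc⟩ := h₃
  have e₁ := eq_add_of_sub_eq' ha
  have e₂ := eq_add_of_sub_eq' hb
  have e₃ := eq_add_of_sub_eq' hc
  have hP : (13 : ℤ) ^ (3 * i + 1) = 13 ^ (3 * i) * 13 := pow_succ _ _
  have hP' : (13 : ℤ) ^ (3 * i) = (13 ^ i) ^ 3 := by rw [mul_comm, pow_mul]
  have d₁ : x₁ - (x₀ + 13 ^ i * u) ∣ x₁ ^ 3 - (x₀ + 13 ^ i * u) ^ 3 := sub_dvd_pow_sub_pow _ _ _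
  have d₂ : x₂ - (x₀ + 2 * (13 ^ i * u)) ∣ x₂ ^ 3 - (x₀ + 2 * (13 ^ i * u)) ^ 3 :=
    sub_dvd_pow_sub_pow _ _ _
  have d₃ : x₃ - (x₀ + 3 * (13 ^ i * u)) ∣ x₃ ^ 3 - (x₀ + 3 * (13 ^ i * u)) ^ 3 :=
    sub_dvd_pow_sub_pow _ _ _
  obtain ⟨a', ha'⟩ := d₁
  obtain ⟨b', hb'⟩ := d₂
  obtain ⟨c', hc'⟩ := d₃
  rw [ha, hP] at ha'
  rw [hb, hP] at hb'
  rw [hc, hP] at hc'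
  -- An exact progression gives `-30d³`. The `xⱼ` form one only modulo `13^(3i+1)`, which changes
  -- `w` by a multiple of 13.
  refine ⟨-30 * u ^ 3 + 13 * (-15 * a * a' + 15 * b * b' - 5 * c * c'), ?_, fun y => ?_⟩
  · linear_combination -15 * ha' + 15 * hb' - 5 * hc' - (-30 * u ^ 3) * hP'
  · have := four_le_abs_cube hu (-15 * a * a' + 15 * b * b' - 5 * c * c' - y)
    convert this using 2
    ring

theorem not_progression_of_third_difference {i : ℕ} {p L : ℤ} (hp : 0 < p) (hL : 13 * L ≤ p)
    {h₀ h₁ h₂ h₃ s₀ s₁ s₂ s₃ j₀ j₁ j₂ j₃ w : ℤ}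
    (hs₀ : s₀ = p * h₀ / 13 ^ (3 * i + 1)) (hs₁ : s₁ = p * h₁ / 13 ^ (3 * i + 1))
    (hs₂ : s₂ = p * h₂ / 13 ^ (3 * i + 1)) (hs₃ : s₃ = p * h₃ / 13 ^ (3 * i + 1))
    (hj₀ : 0 ≤ j₀) (hj₁ : 0 ≤ j₁) (hj₂ : 0 ≤ j₂) (hj₃ : 0 ≤ j₃)
    (hj₀' : j₀ < L) (hj₁' : j₁ < L) (hj₂' : j₂ < L) (hj₃' : j₃ < L)
    (hw : h₀ - 3 * h₁ + 3 * h₂ - h₃ = 13 ^ (3 * i) * w) (hw' : ∀ y, 4 ≤ |w - 13 * y|) :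
    ¬ p ∣ (j₀ + s₀) - 3 * (j₁ + s₁) + 3 * (j₂ + s₂) - (j₃ + s₃) := by
  rintro ⟨y, hy⟩
  set P : ℤ := 13 ^ (3 * i) with hP
  have hP0 : 0 < P := by positivity
  have hP1 : (13 : ℤ) ^ (3 * i + 1) = P * 13 := pow_succ _ _
  rw [hP1] at hs₀ hs₁ hs₂ hs₃
  have hP2 : 0 < P * 13 := by positivity
  have q (h : ℤ) := Int.emod_add_mul_ediv (p * h) (P * 13)
  have r (h : ℤ) := Int.emod_nonneg (p * h) hP2.ne'
  have r' (h : ℤ) := Int.emod_lt_of_pos (p * h) hP2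
  have q₀ := q h₀
  have q₁ := q h₁
  have q₂ := q h₂
  have q₃ := q h₃
  rw [← hs₀] at q₀
  rw [← hs₁] at q₁
  rw [← hs₂] at q₂
  rw [← hs₃] at q₃
  have r₀ := r h₀
  have r₁ := r h₁
  have r₂ := r h₂
  have r₃ := r h₃
  have r₀' := r' h₀
  have r₁' := r' h₁
  have r₂' := r' h₂
  have r₃' := r' h₃
  generalize p * h₀ % (P * 13) = ρ₀ at *
  generalize p * h₁ % (P * 13) = ρ₁ at *
  generalize p * h₂ % (P * 13) = ρ₂ at *
  generalize p * h₃ % (P * 13) = ρ₃ at *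
  have key : ρ₀ - 3 * ρ₁ + 3 * ρ₂ - ρ₃ =
      P * (13 * (j₀ - 3 * j₁ + 3 * j₂ - j₃) + p * (w - 13 * y)) := by
    linear_combination q₀ - 3 * q₁ + 3 * q₂ - q₃ + p * hw - P * 13 * hy
  set z := 13 * (j₀ - 3 * j₁ + 3 * j₂ - j₃) + p * (w - 13 * y) with hz
  have z1 : z < 52 := by
    refine lt_of_mul_lt_mul_left (a := P) ?_ hP0.le
    linarith
  have z2 : -52 < z := by
    refine lt_of_mul_lt_mul_left (a := P) ?_ hP0.le
    linarith
  -- By integrality `jᵢ ≤ L - 1`, so the offsets contribute at most `52L - 52 ≤ 4p - 52` in absolute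
  -- value. The spare 52 is just what the rounding of the starting points can cost.
  rcases le_abs.1 (hw' y) with h | h
  · have : p * 4 ≤ p * (w - 13 * y) := by gcongr
    linarith
  · have : p * 4 ≤ p * -(w - 13 * y) := by gcongr
    linarith

end Cubic

/-! ### Cubic models and their product. -/

/-- The bound for the density of progressions above a difference `d` for the `i`-th cubic model:
differences exactly divisible by `13^i` do not occur at all. -/
noncomputable def cubicBound {m : ℕ} (i : ℕ) (d : ZMod m) : ℝ :=
  if 13 ^ i ∣ d.val ∧ ¬ 13 ^ (i + 1) ∣ d.val then 0 else 7 / 20 / 13 ^ 3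

theorem val_sub_dvd {m : ℕ} [NeZero m] {M : ℤ} (hM : M ∣ m) (v d : ZMod m) (k : ℕ) :
    M ∣ ((v + k * d).val : ℤ) - ((v.val : ℤ) + k * (d.val : ℤ)) := by
  refine hM.trans ?_
  rw [← ZMod.intCast_eq_intCast_iff_dvd_sub]
  simp

theorem val_lt_of_interval_ne_zero {p L : ℕ} {s x : ZMod p} (h : interval s L x ≠ 0) :
    (x - s).val < L := by
  by_contra h'
  exact h (if_neg h')

theorem cubic_progression_eq_zero {m p i : ℕ} [NeZero m] [NeZero p] (hm : 13 ^ (3 * i + 1) ∣ m)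
    {s : ZMod m → ZMod p} (hs : ∀ v, s v = ((p * (5 * v.val ^ 3) / 13 ^ (3 * i + 1) : ℕ) : ZMod p))
    {v d : ZMod m} (hd : 13 ^ i ∣ d.val) (hd' : ¬ 13 ^ (i + 1) ∣ d.val) (u e : ZMod p) :
    interval (s v) (p / 13) (u ^ 2) * interval (s (v + d)) (p / 13) ((u + e) ^ 2) *
      interval (s (v + 2 * d)) (p / 13) ((u + 2 * e) ^ 2) *
      interval (s (v + 3 * d)) (p / 13) ((u + 3 * e) ^ 2) = 0 := by
  by_contra hne
  simp only [mul_eq_zero, not_or] at hne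
  obtain ⟨⟨⟨n₀, n₁⟩, n₂⟩, n₃⟩ := hne
  have hM : (13 : ℤ) ^ (3 * i + 1) ∣ m := by exact_mod_cast hm
  have b₁ := val_sub_dvd hM v d 1
  have b₂ := val_sub_dvd hM v d 2
  have b₃ := val_sub_dvd hM v d 3
  push_cast at b₁ b₂ b₃
  rw [one_mul, one_mul] at b₁
  obtain ⟨w, hw, hw'⟩ := exists_third_difference b₁ b₂ b₃ (by exact_mod_cast hd)
    (by exact_mod_cast hd')
  refine not_progression_of_third_difference (i := i) (p := p) (L := (p / 13 : ℕ))
    (by exact_mod_cast NeZero.pos p) (by exact_mod_cast Nat.mul_div_le p 13) rfl rfl rfl rfl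
    (Int.natCast_nonneg _) (Int.natCast_nonneg _) (Int.natCast_nonneg _) (Int.natCast_nonneg _)
    (Int.ofNat_lt.2 (val_lt_of_interval_ne_zero n₀))
    (Int.ofNat_lt.2 (val_lt_of_interval_ne_zero n₁))
    (Int.ofNat_lt.2 (val_lt_of_interval_ne_zero n₂))
    (Int.ofNat_lt.2 (val_lt_of_interval_ne_zero n₃)) hw hw' ?_
  rw [← ZMod.intCast_zmod_eq_zero_iff_dvd]
  have c (z : ZMod m) (x : ZMod p) : ((((x - s z).val : ℤ) +
      (p : ℤ) * (5 * (z.val : ℤ) ^ 3) / 13 ^ (3 * i + 1) : ℤ) : ZMod p) = x := by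
    have : ((p : ℤ) * (5 * (z.val : ℤ) ^ 3) / 13 ^ (3 * i + 1) : ℤ) =
        ((p * (5 * z.val ^ 3) / 13 ^ (3 * i + 1) : ℕ) : ℤ) := by push_cast; rfl
    rw [this, Int.cast_add, Int.cast_natCast, Int.cast_natCast, ← hs]
    simp
  rw [Int.cast_sub, Int.cast_add, Int.cast_sub, Int.cast_mul, Int.cast_mul, c, c, c, c]
  push_cast
  ring

theorem exists_isModel_cubic {m : ℕ} [NeZero m] {i : ℕ} (hm : 13 ^ (3 * i + 1) ∣ m) {η : ℝ}
    (hη : 0 < η) (B : ℕ) : ∃ (p : ℕ) (_ : NeZero p) (f : ZMod m → ZMod p → ℝ),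
      p.Prime ∧ B < p ∧ IsModel f (1 / 13) η (cubicBound i) := by
  -- The second bound fits the errors into the gap between `1/(3·13³)` and `7/(20·13³)`.
  have hε : 0 < min (η / 2) (1 / 1000000) := by positivity
  have e1 := tendsto_log_pow_div_sqrt.eventually (gt_mem_nhds hε)
  have e2 := (tendsto_one_div_atTop_nhds_zero_nat (𝕜 := ℝ)).eventually (gt_mem_nhds hε)
  obtain ⟨n, hn⟩ := eventually_atTop.1 (e1.and e2)
  obtain ⟨p, hp, hpp⟩ := Nat.exists_infinite_primes (n + B + 3)
  obtain ⟨h1, h2⟩ := hn p (by omega)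
  rw [lt_min_iff] at h1 h2
  have : Fact p.Prime := ⟨hpp⟩
  have hp0 : (0 : ℝ) < p := by exact_mod_cast hpp.pos
  have hL : p / 13 ≤ p := Nat.div_le_self _ _
  set s : ZMod m → ZMod p :=
    fun v => ((p * (5 * v.val ^ 3) / 13 ^ (3 * i + 1) : ℕ) : ZMod p) with hs
  have hmod := isModel_interval (p := p) (by omega) s hL (1 / 13) (τ := cubicBound i)
    (fun v d => by
      unfold cubicBound
      split_ifs with hd
      · refine le_of_eq ?_
        rw [div_eq_zero_iff]
        left
        exact Finset.sum_eq_zero fun u _ => Finset.sum_eq_zero fun e _ =>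
          cubic_progression_eq_zero hm (fun _ => rfl) hd.1 hd.2 u e
      · refine (interval_progression_average_le (by omega) (s v) (s (v + d)) (s (v + 2 * d))
          (s (v + 3 * d)) hL).trans ?_
        have h3 := sum_interval_hyperplane_le (s v) (s (v + d)) (s (v + 2 * d))
          (s (v + 3 * d)) (L := p / 13) (by omega)
        have h4 : ((p / 13 : ℕ) : ℝ) ≤ p / 13 := by
          simpa using (Nat.cast_div_le (α := ℝ) (m := p) (n := 13))
        have h5 : (((p / 13 : ℕ) : ℝ) ^ 2 * ((((p / 13 : ℕ) : ℝ) + 2) / 3)) / (p : ℝ) ^ 3 ≤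
            1 / 6591 + 2 / 507 * (1 / p) := by
          calc _ ≤ ((p / 13 : ℝ) ^ 2 * (((p / 13 : ℝ) + 2) / 3)) / (p : ℝ) ^ 3 := by gcongr
            _ = _ := by field_simp; ring
        have h6 := div_le_div_of_nonneg_right h3 (pow_nonneg hp0.le 3)
        have := h6.trans h5
        linarith [h1.2, h2.2])
  refine ⟨p, inferInstance, _, hpp, by omega, hmod.mono ?_⟩
  have h7 := abs_floor_div_sub_le hpp.pos (t := 1 / 13) (by norm_num)
  have h8 : ⌊(1 / 13 : ℝ) * p⌋₊ = p / 13 := by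
    rw [one_div_mul_eq_div]
    exact_mod_cast Nat.floor_div_natCast (p : ℝ) 13 |>.trans (by simp)
  rw [h8] at h7
  have := log_div_sqrt_le p
  linarith [h1.1, h2.1]

/-- The product of the first `j` cubic models. -/
theorem exists_isModel_prod {m : ℕ} [NeZero m] {k : ℕ} (hm : 13 ^ (3 * k) ∣ m) (j : ℕ)
    (hj : j ≤ k) : ∀ {η : ℝ}, 0 < η → ∃ (Q : ℕ) (_ : NeZero Q) (f : ZMod m → ZMod Q → ℝ),
      m.Coprime Q ∧ IsModel f ((1 / 13) ^ j) η (fun d => ∏ i ∈ range j, cubicBound i d) := by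
  induction j with
  | zero =>
    intro η hη
    refine ⟨1, inferInstance, fun _ _ => 1, Nat.coprime_one_right m, fun _ _ => Or.inr rfl,
      fun v χ => ?_, fun v d => ?_⟩
    · have : χ = 0 := by
        ext x
        rw [Subsingleton.elim x 0]
        simp
      subst this
      simpa using hη.le
    · simp
  | succ j ih =>
    intro η hη
    obtain ⟨Q, hQ, f, hc, hf⟩ := ih (by omega) (half_pos hη)
    -- A prime exceeding `m * Q` is coprime to it, as the Chinese remainder theorem requires.
    obtain ⟨p, hp, g, hpp, hpB, hg⟩ := exists_isModel_cubic (m := m) (i := j)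
      ((pow_dvd_pow 13 (by omega)).trans hm) (half_pos hη) (m * Q)
    have hmQ : 0 < m * Q := Nat.mul_pos (NeZero.pos m) (NeZero.pos Q)
    have hcop : (m * Q).Coprime p :=
      (Nat.coprime_of_lt_prime hmQ.ne' hpB hpp).symm
    have hmod := (hf.mul hg (by
      rw [abs_of_nonneg (by positivity)]
      exact pow_le_one₀ (by norm_num) (by norm_num))).comp_ringEquiv
        (ZMod.chineseRemainder (Nat.Coprime.coprime_mul_left hcop))
    simp only [← Finset.prod_range_succ, ← pow_succ, add_halves] at hmod
    exact ⟨Q * p, inferInstance, _, hc.mul_right (Nat.Coprime.coprime_mul_right hcop), hmod⟩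

/-- If `13^k` does not divide `d`, the exact power of 13 in `d` is some `13^i` with `i < k`, and the
`i`-th factor vanishes. -/
theorem prod_cubicBound_le {m k : ℕ} (d : ZMod m) :
    ∏ i ∈ range k, cubicBound i d ≤ if 13 ^ k ∣ d.val then (7 / 20 / 13 ^ 3 : ℝ) ^ k else 0 := by
  have h0 (i : ℕ) : 0 ≤ cubicBound i d := by unfold cubicBound; split_ifs <;> norm_num
  have h1 (i : ℕ) : cubicBound i d ≤ 7 / 20 / 13 ^ 3 := by
    unfold cubicBound; split_ifs <;> norm_num
  split_ifs with h
  · calc _ ≤ ∏ _i ∈ range k, (7 / 20 / 13 ^ 3 : ℝ) :=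
        Finset.prod_le_prod (fun i _ => h0 i) fun i _ => h1 i
      _ = _ := by rw [Finset.prod_const, Finset.card_range]
  · have hex : ∃ j, ¬ 13 ^ j ∣ d.val := ⟨k, h⟩
    classical
    set j := Nat.find hex with hj
    have hj1 : ¬ 13 ^ j ∣ d.val := Nat.find_spec hex
    have hjk : j ≤ k := Nat.find_min' hex h
    have hj0 : j ≠ 0 := by
      intro h0
      rw [h0] at hj1
      simp at hj1
    obtain ⟨i, hi⟩ := Nat.exists_eq_succ_of_ne_zero hj0
    have hi1 : 13 ^ i ∣ d.val := by
      by_contra hcon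
      have := Nat.find_min' hex hcon
      omega
    refine le_of_eq (Finset.prod_eq_zero (i := i) (by simp; omega) ?_)
    rw [hi] at hj1
    exact if_pos ⟨hi1, hj1⟩

theorem card_dvd_val_le {m D : ℕ} [NeZero m] (hD : D ∣ m) :
    (univ.filter fun d : ZMod m => D ∣ d.val).card ≤ m / D := by
  have hD0 : 0 < D := Nat.pos_of_dvd_of_pos hD (NeZero.pos m)
  conv_rhs => rw [← Finset.card_range (m / D)]
  refine Finset.card_le_card_of_injOn (fun d => d.val / D) (fun d hd => ?_)
    (fun d hd d' hd' h => ?_)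
  · have := ZMod.val_lt d
    simp only [coe_range, Set.mem_Iio]
    exact Nat.div_lt_div_of_lt_of_dvd hD this
  · simp only [coe_filter, mem_univ, true_and, Set.mem_ofPred_eq] at hd hd'
    apply ZMod.val_injective m
    rw [← Nat.div_mul_cancel hd, ← Nat.div_mul_cancel hd']
    simp only at h
    rw [h]

theorem average_prod_cubicBound_le {m k : ℕ} [NeZero m] (hm : 13 ^ k ∣ m) :
    (∑ d : ZMod m, ∏ i ∈ range k, cubicBound i d) / m ≤ (7 / 20 / 13 ^ 4 : ℝ) ^ k := by
  have hm0 : (0 : ℝ) < m := by exact_mod_cast NeZero.pos m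
  rw [div_le_iff₀ hm0]
  calc _ ≤ ∑ d : ZMod m, if 13 ^ k ∣ d.val then (7 / 20 / 13 ^ 3 : ℝ) ^ k else 0 :=
        Finset.sum_le_sum fun d _ => prod_cubicBound_le d
    _ = (univ.filter fun d : ZMod m => 13 ^ k ∣ d.val).card * (7 / 20 / 13 ^ 3 : ℝ) ^ k := by
        rw [← Finset.sum_filter, Finset.sum_const, nsmul_eq_mul]
    _ ≤ (m / 13 ^ k : ℝ) * (7 / 20 / 13 ^ 3 : ℝ) ^ k := by
        gcongr
        calc _ ≤ ((m / 13 ^ k : ℕ) : ℝ) := by exact_mod_cast card_dvd_val_le hm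
          _ ≤ _ := by
            have := (Nat.cast_div_le (α := ℝ) (m := m) (n := 13 ^ k))
            exact_mod_cast this
    _ = _ := by
        rw [div_mul_eq_mul_div, mul_div_assoc, ← div_pow, mul_comm]
        norm_num

/-- For `α < 13^(-k)`, Fourier uniform sets of density `α` with few four-term progressions. -/
theorem exists_uniform_finset {k : ℕ} {α : ℝ} (hα : 0 < α) (hαk : α < (1 / 13) ^ k) {η : ℝ}
    (hη : 0 < η) (N₀ : ℕ) : ∃ (N : ℕ) (_ : NeZero N) (A : Finset (ZMod N)), N₀ ≤ N ∧
      FourierUniform η A ∧ α * N ≤ A.card ∧ A.card ≤ (α + η) * N ∧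
      apDensity A ≤ (7 / 20 / 13 ^ 4 : ℝ) ^ k := by
  -- The target density is `α + ε` with error at most `ε`, so the outcome lies in `[α, α + 2ε]`. The
  -- second bound keeps the density of the tuning factor at most 1.
  set ε := min (η / 2) ((1 / 13) ^ k - α) with hε
  have hε0 : 0 < ε := lt_min (half_pos hη) (sub_pos.2 hαk)
  have hε1 : ε ≤ η / 2 := min_le_left _ _
  have hε2 : ε ≤ (1 / 13) ^ k - α := min_le_right _ _
  set m := 13 ^ (3 * k) with hm
  have : NeZero m := ⟨by positivity⟩
  obtain ⟨Q, hQ, f, hc, hf⟩ := exists_isModel_prod (m := m) (k := k) dvd_rfl k le_rfl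
    (half_pos hε0)
  have hk : (0 : ℝ) < (1 / 13) ^ k := by positivity
  obtain ⟨p, hp, g, hpp, hpB, hg⟩ := exists_isModel_of_density m (δ := (α + ε) / (1 / 13) ^ k)
    (by positivity) (by rw [div_le_one hk]; linarith) (half_pos hε0) (m * Q + N₀)
  have hmQ : 0 < m * Q := Nat.mul_pos (NeZero.pos m) (NeZero.pos Q)
  have hcop : (m * Q).Coprime p := (Nat.coprime_of_lt_prime hmQ.ne' (by omega) hpp).symm
  have hmod := (hf.mul hg (by
    rw [abs_of_nonneg (by positivity)]
    exact pow_le_one₀ (by norm_num) (by norm_num))).comp_ringEquiv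
      (ZMod.chineseRemainder (Nat.Coprime.coprime_mul_left hcop))
  rw [mul_div_cancel₀ _ hk.ne', add_halves] at hmod
  simp only [mul_one] at hmod
  obtain ⟨A, hA, hcard, hap⟩ :=
    hmod.exists_finset (hc.mul_right (Nat.Coprime.coprime_mul_right hcop))
  have hN : (0 : ℝ) < (m * (Q * p) : ℕ) := by exact_mod_cast NeZero.pos _
  refine ⟨m * (Q * p), inferInstance, A, ?_, fun r hr => (hA r hr).trans (by linarith), ?_, ?_,
    hap.trans (average_prod_cubicBound_le (pow_dvd_pow 13 (by omega)))⟩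
  · calc N₀ ≤ p := by omega
      _ ≤ m * Q * p := Nat.le_mul_of_pos_left _ hmQ
      _ = _ := by ring
  · rw [← le_div_iff₀ hN]
    linarith [(abs_le.1 hcard).1]
  · rw [← div_le_iff₀ hN]
    linarith [(abs_le.1 hcard).2]

/-! ### Exponents and the bound for `rho`. -/

theorem thirteen_rpow_le : (13 : ℝ) ^ (0.407 : ℝ) ≤ 20 / 7 := by
  calc (13 : ℝ) ^ (0.407 : ℝ) ≤ 13 ^ (49 / 120 : ℝ) :=
        Real.rpow_le_rpow_of_exponent_le (by norm_num) (by norm_num)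
    _ ≤ 20 / 7 := by
        rw [← Real.rpow_le_rpow_iff (z := 120) (by positivity) (by positivity) (by norm_num),
          ← Real.rpow_mul (by norm_num)]
        norm_num

theorem logb_three_le : 3 + (1 / 2 : ℝ) * Real.logb 3 22 ≤ 4.407 := by
  have : Real.logb 3 22 ≤ 121 / 43 := by
    rw [Real.logb_le_iff_le_rpow (by norm_num) (by norm_num),
      ← Real.rpow_le_rpow_iff (z := 43) (by positivity) (by positivity) (by norm_num),
      ← Real.rpow_mul (by norm_num)]
    norm_num
  linarith

theorem exists_pow_le_lt {α : ℝ} (hα : 0 < α) (hα' : α < 1) :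
    ∃ k : ℕ, (1 / 13 : ℝ) ^ (k + 1) ≤ α ∧ α < (1 / 13) ^ k := by
  obtain ⟨n, h1, h2⟩ := exists_nat_pow_near_of_lt_one (y := (1 / 13 : ℝ)) hα hα'.le (by norm_num)
    (by norm_num)
  rcases h2.lt_or_eq with h | h
  · exact ⟨n, h1.le, h⟩
  -- When `α` is a power of `1/13`, drop one power: strictness leaves room for `ε` above.
  · cases n with
    | zero => simp [h] at hα'
    | succ k => exact ⟨k, h.ge, h ▸ pow_lt_pow_right_of_lt_one₀ (by norm_num) (by norm_num)
        (Nat.lt_succ_self k)⟩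

theorem density_pow_le {k : ℕ} {α : ℝ} (h : (1 / 13 : ℝ) ^ (k + 1) ≤ α) :
    (7 / 20 / 13 ^ 4 : ℝ) ^ k ≤ 13 ^ (4.407 : ℝ) * α ^ (4.407 : ℝ) := by
  have h1 : (7 / 20 / 13 ^ 4 : ℝ) ≤ (1 / 13) ^ (4.407 : ℝ) := by
    have e : (1 / 13 : ℝ) ^ (4.407 : ℝ) = 1 / (13 ^ 4 * 13 ^ (0.407 : ℝ)) := by
      rw [Real.div_rpow (by norm_num) (by norm_num), Real.one_rpow, ← Real.rpow_natCast,
        ← Real.rpow_add (by norm_num)]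
      norm_num
    rw [e, div_div, div_le_div_iff₀ (by norm_num) (by positivity)]
    have := thirteen_rpow_le
    linarith
  calc (7 / 20 / 13 ^ 4 : ℝ) ^ k ≤ ((1 / 13) ^ (4.407 : ℝ)) ^ k := by gcongr
    _ = 13 ^ (4.407 : ℝ) * ((1 / 13 : ℝ) ^ (k + 1)) ^ (4.407 : ℝ) := by
      rw [← Real.rpow_natCast, ← Real.rpow_mul (by norm_num), mul_comm, Real.rpow_mul (by norm_num),
        ← Real.mul_rpow (by norm_num) (by positivity), Real.rpow_natCast]
      congr 1
      rw [pow_succ]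
      ring
    _ ≤ _ := by gcongr

theorem exists_uniform_finset_rpow {α : ℝ} (hα : 0 < α) (hα' : α < 1) {η : ℝ} (hη : 0 < η)
    (N₀ : ℕ) : ∃ (N : ℕ) (_ : NeZero N) (A : Finset (ZMod N)), N₀ ≤ N ∧
      FourierUniform η A ∧ α * N ≤ A.card ∧ A.card ≤ (α + η) * N ∧
      apDensity A ≤ 13 ^ (4.407 : ℝ) * α ^ (4.407 : ℝ) := by
  obtain ⟨k, hk, hk'⟩ := exists_pow_le_lt hα hα'
  obtain ⟨N, hN, A, h1, h2, h3, h4, h5⟩ := exists_uniform_finset hα hk' hη N₀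
  exact ⟨N, hN, A, h1, h2, h3, h4, h5.trans (density_pow_le hk)⟩

/-- Each admissible `c` is tested, for every `ε`, against a constructed set that meets its `η` and
`N₀`. -/
theorem abs_rho_le {α : ℝ} (hα : 0 < α) (hα' : α < 1) :
    |rho α| ≤ 13 ^ (4.407 : ℝ) * α ^ (4.407 : ℝ) := by
  rw [rho, abs_of_nonneg (le_csSup (bddAbove_admissible hα) (zero_mem_admissible α))]
  refine csSup_le ⟨0, zero_mem_admissible α⟩ fun c hc => le_of_forall_pos_le_add fun ε hε => ?_
  obtain ⟨η, hη, N₀, h⟩ := hc ε hε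
  obtain ⟨N, hN, A, h1, h2, h3, -, h5⟩ := exists_uniform_finset_rpow hα hα' hη N₀
  have h6 := h N h1 A h2 (le_trans (by gcongr; linarith) h3)
  linarith

theorem mul_rpow_lt_rpow {α : ℝ} (hα : 0 < α) (h : α < (13 ^ (4.407 : ℝ))⁻¹ ^ (1000 / 7 : ℝ)) :
    13 ^ (4.407 : ℝ) * α ^ (4.407 : ℝ) < α ^ (4.4 : ℝ) := by
  -- The surplus exponent `0.007 = 4.407 - 4.4` absorbs the constant; its inverse is the `1000 / 7`
  -- in the threshold.
  have h1 : α ^ (0.007 : ℝ) < (13 ^ (4.407 : ℝ))⁻¹ := by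
    have := Real.rpow_lt_rpow hα.le h (z := 0.007) (by norm_num)
    rw [← Real.rpow_mul (by positivity)] at this
    norm_num at this ⊢
    exact this
  have h2 : α ^ (4.407 : ℝ) = α ^ (0.007 : ℝ) * α ^ (4.4 : ℝ) := by
    rw [← Real.rpow_add hα]; norm_num
  have h3 : 0 < α ^ (4.4 : ℝ) := by positivity
  have h4 : (0 : ℝ) < 13 ^ (4.407 : ℝ) := by positivity
  rw [h2, ← mul_assoc]
  refine mul_lt_of_lt_one_left h3 ?_
  rwa [← lt_inv_mul_iff₀ h4, mul_one]

end FourAP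

theorem mainTheorem3 :
    (∃ C : ℝ, 0 < C ∧ ∀ α : ℝ, 0 < α → α < 1 →
      |FourAP.rho α| ≤ C * α ^ (3 + (1 / 2 : ℝ) * Real.logb 3 22)) ∧
    (∃ C : ℝ, 0 < C ∧ ∀ α : ℝ, 0 < α → α < 1 →
      |FourAP.rho α| ≤ C * α ^ (4.406 : ℝ)) ∧
    (∃ α₀ : ℝ, 0 < α₀ ∧ ∀ α : ℝ, 0 < α → α < α₀ → FourAP.rho α < α ^ (4.4 : ℝ)) ∧
    (∃ α₀ : ℝ, 0 < α₀ ∧ ∀ α : ℝ, 0 < α → α < α₀ →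
      ∀ η : ℝ, 0 < η → ∀ N₀ : ℕ, ∃ (N : ℕ) (_ : NeZero N) (A : Finset (ZMod N)),
        N₀ ≤ N ∧ FourAP.FourierUniform η A ∧
        α * (N : ℝ) ≤ (A.card : ℝ) ∧ (A.card : ℝ) ≤ (α + η) * (N : ℝ) ∧
        FourAP.apDensity A < α ^ (4.4 : ℝ)) := by
  have hlt : ((13 : ℝ) ^ (4.407 : ℝ))⁻¹ ^ (1000 / 7 : ℝ) ≤ 1 :=
    Real.rpow_le_one (by positivity)
      (inv_le_one_of_one_le₀ (Real.one_le_rpow (by norm_num) (by norm_num))) (by norm_num)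
  refine ⟨⟨13 ^ (4.407 : ℝ), by positivity, fun α hα hα' => ?_⟩,
    ⟨13 ^ (4.407 : ℝ), by positivity, fun α hα hα' => ?_⟩,
    ⟨(13 ^ (4.407 : ℝ))⁻¹ ^ (1000 / 7 : ℝ), by positivity, fun α hα hα' => ?_⟩,
    ⟨(13 ^ (4.407 : ℝ))⁻¹ ^ (1000 / 7 : ℝ), by positivity, fun α hα hα' η hη N₀ => ?_⟩⟩
  · refine (FourAP.abs_rho_le hα hα').trans (mul_le_mul_of_nonneg_left ?_ (by positivity))
    exact Real.rpow_le_rpow_of_exponent_ge hα hα'.le FourAP.logb_three_le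
  · refine (FourAP.abs_rho_le hα hα').trans (mul_le_mul_of_nonneg_left ?_ (by positivity))
    exact Real.rpow_le_rpow_of_exponent_ge hα hα'.le (by norm_num)
  · exact (le_abs_self _).trans_lt
      ((FourAP.abs_rho_le hα (hα'.trans_le hlt)).trans_lt (FourAP.mul_rpow_lt_rpow hα hα'))
  · obtain ⟨N, hN, A, h1, h2, h3, h4, h5⟩ :=
      FourAP.exists_uniform_finset_rpow hα (hα'.trans_le hlt) hη N₀
    exact ⟨N, hN, A, h1, h2, h3, h4, h5.trans_lt (FourAP.mul_rpow_lt_rpow hα hα')⟩
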